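/- Let $n\ge 1$ and let $\mu_n$ be the group of $n$-th roots of unity, acting diagonally on $\mathbb{C}^n$, with quotient map $q:\mathbb{C}^n\setminus\{0\}\to(\mathbb{C}^n\setminus\{0\})/\mu_n$ onto the quotient complex manifold. Let $$\mathcal{O}_{\mathbb{CP}^{n-1}}(-n)=\{(z,[\xi])\in\mathbb{C}^n\times\mathbb{CP}^{n-1} : z^i(\xi^j)^n=z^j(\xi^i)^n \text{ for all } i,j\}$$ with its complex manifold structure, let $\mathbb{CP}^{n-1}=\{z=0\}$ be its zero section, and let $\pi:\mathcal{O}_{\mathbb{CP}^{n-1}}(-n)\setminus\mathbb{CP}^{n-1}\to(\mathbb{C}^n\setminus\{0\})/\mu_n$ be the blow-down map, which sends $(z,[\xi])$ to the class of any $w$ on the line $[\xi]$ with $(w^k)^n=z^k$ for all $k$. Then the form $dz^1\wedge\dots\wedge dz^n$ descends to a holomorphic $n$-form $\eta^{\mathbb{C}}$ on $(\mathbb{C}^n\setminus\{0\})/\mu_n$, that is, $q^*\eta^{\mathbb{C}}=dz^1\wedge\dots\wedge dz^n$, and $\pi^*\eta^{\mathbb{C}}$ extends to a nowhere-vanishing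 holomorphic $n$-form $\eta$ on $\mathcal{O}_{\mathbb{CP}^{n-1}}(-n)$. Moreover, for every $a>0$, the metric (the Ricci-flat Calabi–Eguchi–Hanson metric) that is given off the zero section, in the coordinates $z$ of $\mathbb{C}^n\setminus\{0\}$ and with $u=|z|^2$, by $$g_{\mu\bar\nu}=\sqrt[n]{1+\frac{a^n}{u^n}}\left(\delta_{\mu\bar\nu}-\frac{a^n}{a^n+u^n}\,\frac{\bar z_\mu z_\nu}{u}\right)$$ extends to a smooth Riemannian metric on $\mathcal{O}_{\mathbb{CP}^{n-1}}(-n)$, and $\eta$ is parallel with respect to the Levi-Civita connection of this metric. -/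

import Mathlib

open scoped Manifold ContDiff Topology LinearAlgebra.Projectivization
open Bundle

noncomputable section

namespace CalabiEguchiHanson

/-- The complex Euclidean space `ℂⁿ`. -/
abbrev Cn (n : ℕ) : Type := EuclideanSpace ℂ (Fin n)

/-! ### The total space of `𝒪(-n)` over `ℂℙⁿ⁻¹` as a complex manifold -/

/-- `ℂℙⁿ⁻¹` carries the quotient topology of `ℂⁿ ∖ 0`. -/
instance instTopologicalSpaceProj (n : ℕ) : TopologicalSpace (ℙ ℂ (Cn n)) :=
  inferInstanceAs (TopologicalSpace (Quotient (projectivizationSetoid ℂ (Cn n))))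

/-- The total space of `𝒪(-n)` over `ℂℙⁿ⁻¹`, realised as
`{(z, [ξ]) | zⁱ (ξʲ)ⁿ = zʲ (ξⁱ)ⁿ} ⊆ ℂⁿ × ℂℙⁿ⁻¹`. -/
def OMinus (n : ℕ) : Type :=
  {p : Cn n × ℙ ℂ (Cn n) // ∀ i j, p.1 i * p.2.rep j ^ n = p.1 j * p.2.rep i ^ n}

instance instTopologicalSpaceOMinus (n : ℕ) : TopologicalSpace (OMinus n) :=
  inferInstanceAs (TopologicalSpace
    {p : Cn n × ℙ ℂ (Cn n) // ∀ i j, p.1 i * p.2.rep j ^ n = p.1 j * p.2.rep i ^ n})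

/-- The representative `ξ` with `ξⁱ = 1` of the point of `ℂℙⁿ⁻¹` with affine coordinates `yᵏ`,
`k ≠ i`. -/
def affineRep {n : ℕ} (i : Fin n) (y : Cn n) : Cn n :=
  WithLp.toLp 2 (fun k => if k = i then 1 else y k)

theorem affineRep_ne_zero {n : ℕ} (i : Fin n) (y : Cn n) : affineRep i y ≠ 0 := fun h => by
  have := congrArg (fun v : Cn n => v i) h
  simp [affineRep] at this

theorem contDiff_affineRep {n : ℕ} (i k : Fin n) :
    ContDiff ℂ ω (fun y : Cn n => affineRep i y k) := by
  by_cases hk : k = i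
  · simpa [affineRep, hk] using contDiff_const
  · simp only [affineRep, hk, if_false]; fun_prop

theorem exists_rep_mk {n : ℕ} (ξ : Cn n) (hξ : ξ ≠ 0) :
    ∃ c : ℂ, c ≠ 0 ∧ (Projectivization.mk ℂ ξ hξ).rep = c • ξ := by
  obtain ⟨a, ha⟩ := Projectivization.exists_smul_eq_mk_rep ℂ ξ hξ
  exact ⟨a, a.ne_zero, ha.symm⟩

/-- The affine coordinates `ξᵏ / ξⁱ` of a point of `ℂℙⁿ⁻¹`. -/
def ratio {n : ℕ} (i k : Fin n) (l : ℙ ℂ (Cn n)) : ℂ := l.rep k / l.rep i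

theorem ratio_mk {n : ℕ} (i k : Fin n) (ξ : Cn n) (hξ : ξ ≠ 0) :
    ratio i k (Projectivization.mk ℂ ξ hξ) = ξ k / ξ i := by
  obtain ⟨c, hc, h⟩ := exists_rep_mk ξ hξ
  simp [ratio, h, mul_div_mul_left _ _ hc]

theorem rep_mk_ne_zero_iff {n : ℕ} (i : Fin n) (ξ : Cn n) (hξ : ξ ≠ 0) :
    (Projectivization.mk ℂ ξ hξ).rep i ≠ 0 ↔ ξ i ≠ 0 := by
  obtain ⟨c, hc, h⟩ := exists_rep_mk ξ hξ
  simp [h, hc]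

theorem mk_isQuotientMap (n : ℕ) :
    Topology.IsQuotientMap (fun v : {v : Cn n // v ≠ 0} => Projectivization.mk ℂ v.1 v.2) :=
  isQuotientMap_quot_mk

theorem isOpen_rep_ne_zero {n : ℕ} (i : Fin n) : IsOpen {l : ℙ ℂ (Cn n) | l.rep i ≠ 0} := by
  rw [← (mk_isQuotientMap n).isOpen_preimage]
  have : (fun v : {v : Cn n // v ≠ 0} => Projectivization.mk ℂ v.1 v.2) ⁻¹'
      {l : ℙ ℂ (Cn n) | l.rep i ≠ 0} = {v | v.1 i ≠ 0} := by
    ext v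
    exact rep_mk_ne_zero_iff i v.1 v.2
  rw [this]
  exact isOpen_ne_fun (by fun_prop) continuous_const

theorem continuousOn_ratio {n : ℕ} (i k : Fin n) :
    ContinuousOn (ratio i k) {l : ℙ ℂ (Cn n) | l.rep i ≠ 0} := by
  rw [(mk_isQuotientMap n).continuousOn_isOpen_iff (isOpen_rep_ne_zero i)]
  have h : ContinuousOn (fun v : {v : Cn n // v ≠ 0} => v.1 k / v.1 i)
      ((fun v : {v : Cn n // v ≠ 0} => Projectivization.mk ℂ v.1 v.2) ⁻¹'
        {l : ℙ ℂ (Cn n) | l.rep i ≠ 0}) :=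
    ContinuousOn.div (by fun_prop) (by fun_prop)
      fun v hv => (rep_mk_ne_zero_iff i v.1 v.2).1 hv
  exact h.congr fun v _ => ratio_mk i k v.1 v.2

theorem mk_mem_OMinus {n : ℕ} (ξ : Cn n) (hξ : ξ ≠ 0) (t : ℂ) (i j : Fin n) :
    (WithLp.toLp 2 (fun k => t * ξ k ^ n) : Cn n) i *
        (Projectivization.mk ℂ ξ hξ).rep j ^ n =
      (WithLp.toLp 2 (fun k => t * ξ k ^ n) : Cn n) j *
        (Projectivization.mk ℂ ξ hξ).rep i ^ n := by
  obtain ⟨c, hc, h⟩ := exists_rep_mk ξ hξ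
  simp [h, mul_pow]
  ring

/-- The point `(t (ξ¹)ⁿ, …, t (ξⁿ)ⁿ; [ξ])` of `𝒪(-n)`. -/
def OMinus.mk {n : ℕ} (ξ : Cn n) (hξ : ξ ≠ 0) (t : ℂ) : OMinus n :=
  ⟨(WithLp.toLp 2 (fun k => t * ξ k ^ n), Projectivization.mk ℂ ξ hξ), mk_mem_OMinus ξ hξ t⟩

theorem affineRep_ratio {n : ℕ} (i : Fin n) (l : ℙ ℂ (Cn n)) (hl : l.rep i ≠ 0) (y : Cn n)
    (hy : ∀ k ≠ i, y k = ratio i k l) :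
    affineRep i y = (l.rep i)⁻¹ • l.rep := by
  ext k
  by_cases hk : k = i
  · subst hk; simp [affineRep, hl]
  · simp [affineRep, hk, hy k hk, ratio, div_eq_inv_mul]

/-- The standard chart of `𝒪(-n)` over `{ξⁱ ≠ 0}`: the `i`-th coordinate is the fibre coordinate
`zⁱ`, the others are the affine coordinates `ζᵏ = ξᵏ / ξⁱ`. Its inverse sends `y` to
`((ζ¹)ⁿ zⁱ, …, zⁱ, …, (ζⁿ)ⁿ zⁱ; [ζ¹ : … : 1 : … : ζⁿ])`. -/
def chart {n : ℕ} (i : Fin n) : OpenPartialHomeomorph (OMinus n) (Cn n) where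
  toFun p := WithLp.toLp 2 (fun k => if k = i then p.1.1 i else ratio i k p.1.2)
  invFun y := OMinus.mk (affineRep i y) (affineRep_ne_zero i y) (y i)
  source := {p | p.1.2.rep i ≠ 0}
  target := Set.univ
  map_source' _ _ := Set.mem_univ _
  map_target' y _ := by
    change (Projectivization.mk ℂ (affineRep i y) (affineRep_ne_zero i y)).rep i ≠ 0
    rw [rep_mk_ne_zero_iff]
    simp [affineRep]
  left_inv' := by
    rintro ⟨⟨z, l⟩, h⟩ hl
    change l.rep i ≠ 0 at hl
    have hr : affineRep i (WithLp.toLp 2 (fun k => if k = i then z i else ratio i k l)) =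
        (l.rep i)⁻¹ • l.rep :=
      affineRep_ratio i l hl _ fun k hk => by simp [hk]
    apply Subtype.ext
    apply Prod.ext
    · ext k
      change _ * _ ^ n = z k
      rw [hr]
      have := h i k
      simp only [PiLp.smul_apply, smul_eq_mul, mul_pow, inv_pow, if_true]
      field_simp
      simpa [mul_comm] using this
    · change Projectivization.mk ℂ _ _ = l
      conv_rhs => rw [← l.mk_rep]
      rw [Projectivization.mk_eq_mk_iff']
      exact ⟨_, hr.symm⟩
  right_inv' y _ := by
    ext k
    by_cases hk : k = i
    · subst hk
      simp [OMinus.mk, affineRep]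
    · simp [OMinus.mk, hk, ratio_mk, affineRep]
  open_source := (isOpen_rep_ne_zero i).preimage (continuous_snd.comp continuous_subtype_val)
  open_target := isOpen_univ
  continuousOn_toFun := by
    apply (PiLp.continuous_toLp 2 _).comp_continuousOn
    rw [continuousOn_pi]
    intro k
    by_cases hk : k = i
    · simp only [hk, if_true]
      exact (Continuous.comp (by fun_prop : Continuous fun v : Cn n => v i)
        (continuous_fst.comp continuous_subtype_val)).continuousOn
    · simp only [hk, if_false]
      exact (continuousOn_ratio i k).comp
        (continuous_snd.comp continuous_subtype_val).continuousOn fun p hp => hp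
  continuousOn_invFun := by
    have hc : Continuous (affineRep i : Cn n → Cn n) :=
      (PiLp.continuous_toLp 2 _).comp
        (continuous_pi fun k => (contDiff_affineRep i k).continuous)
    apply Continuous.continuousOn
    apply Continuous.subtype_mk
    apply Continuous.prodMk
    · apply (PiLp.continuous_toLp 2 _).comp
      refine continuous_pi fun k => ?_
      exact Continuous.mul (by fun_prop) ((contDiff_affineRep i k).continuous.pow n)
    · exact (mk_isQuotientMap n).continuous.comp (hc.subtype_mk fun y => affineRep_ne_zero i y)

theorem exists_rep_ne_zero {n : ℕ} (p : OMinus n) : ∃ i, p.1.2.rep i ≠ 0 := by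
  by_contra! h
  exact p.1.2.rep_nonzero (by ext i; simpa using h i)

instance instChartedSpaceOMinus (n : ℕ) : ChartedSpace (Cn n) (OMinus n) where
  atlas := Set.range chart
  chartAt p := chart (exists_rep_ne_zero p).choose
  mem_chart_source p := (exists_rep_ne_zero p).choose_spec
  chart_mem_atlas _ := Set.mem_range_self _

theorem contDiffOn_transition {n : ℕ} (i j : Fin n) :
    ContDiffOn ℂ ω ((chart i).symm ≫ₕ chart j) ((chart i).symm ≫ₕ chart j).source := by
  have hs : ∀ y ∈ ((chart i).symm ≫ₕ chart j).source, affineRep i y j ≠ 0 := by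
    intro y hy
    have h : (Projectivization.mk ℂ (affineRep i y) (affineRep_ne_zero i y)).rep j ≠ 0 := hy.2
    rwa [rep_mk_ne_zero_iff] at h
  have hc := contDiff_affineRep i
  rw [contDiffOn_piLp]
  intro k
  by_cases hk : k = j
  · have : ContDiff ℂ ω (fun y : Cn n => y i * affineRep i y j ^ n) :=
      ContDiff.mul (by fun_prop) ((hc j).pow n)
    refine this.contDiffOn.congr fun y _ => ?_
    change (if k = j then y i * affineRep i y j ^ n else _) = _
    simp [hk]
  · refine (ContDiffOn.div (hc k).contDiffOn (hc j).contDiffOn hs).congr fun y _ => ?_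
    change (if k = j then _ else ratio j k (Projectivization.mk ℂ (affineRep i y) _)) = _
    simp [hk, ratio_mk]

instance instIsManifoldOMinus (n : ℕ) : IsManifold 𝓘(ℂ, Cn n) ω (OMinus n) := by
  apply isManifold_of_contDiffOn
  rintro _ _ ⟨i, rfl⟩ ⟨j, rfl⟩
  simpa using contDiffOn_transition i j

instance instIsManifoldOMinusReal (n : ℕ) : IsManifold 𝓘(ℝ, Cn n) ω (OMinus n) := by
  apply isManifold_of_contDiffOn
  rintro _ _ ⟨i, rfl⟩ ⟨j, rfl⟩
  simpa using (contDiffOn_transition i j).restrict_scalars ℝ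

/-! ### The complex manifold `(ℂⁿ ∖ 0) / μₙ` -/

/-- `ℂⁿ ∖ 0`. -/
def punctured (n : ℕ) : TopologicalSpace.Opens (Cn n) := ⟨{0}ᶜ, isOpen_compl_singleton⟩

theorem punctured_ne_zero {n : ℕ} (z : punctured n) : (z : Cn n) ≠ 0 := z.2

/-- The diagonal action of the `n`-th roots of unity on `ℂⁿ ∖ 0`. -/
instance instMulActionPunctured (n : ℕ) : MulAction (rootsOfUnity n ℂ) (punctured n) where
  smul ζ z := ⟨ζ • (z : Cn n), fun h => punctured_ne_zero z (by
    simpa [Subgroup.smul_def, Units.smul_def] using h)⟩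
  one_smul z := Subtype.ext (one_smul _ (z : Cn n))
  mul_smul ζ ζ' z := Subtype.ext (mul_smul ζ ζ' (z : Cn n))

theorem coe_smul {n : ℕ} (ζ : rootsOfUnity n ℂ) (z : punctured n) :
    ((ζ • z : punctured n) : Cn n) = ((ζ : ℂˣ) : ℂ) • (z : Cn n) := rfl

instance instContinuousConstSMulPunctured (n : ℕ) :
    ContinuousConstSMul (rootsOfUnity n ℂ) (punctured n) where
  continuous_const_smul ζ := Continuous.subtype_mk
    (continuous_subtype_val.const_smul ((ζ : ℂˣ) : ℂ)) _

instance instIsCancelSMulPunctured (n : ℕ) : IsCancelSMul (rootsOfUnity n ℂ) (punctured n) where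
  right_cancel' ζ ζ' z h := by
    have h' := congrArg (fun w : punctured n => (w : Cn n)) h
    simp only [coe_smul] at h'
    exact Subtype.ext (Units.ext (smul_left_injective ℂ (punctured_ne_zero z) h'))

instance instLocallyCompactSpacePunctured (n : ℕ) : LocallyCompactSpace (punctured n) :=
  (punctured n).isOpen.locallyCompactSpace

/-- The quotient `(ℂⁿ ∖ 0) / μₙ`, with the manifold structure of Mathlib on the quotient by a free
properly discontinuous action: the charts are local inverses of the quotient map. -/
abbrev PuncturedQuotient (n : ℕ) [NeZero n] : Type :=
  MulAction.orbitRel.Quotient (rootsOfUnity n ℂ) (punctured n)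

/-- The quotient map `ℂⁿ ∖ 0 → (ℂⁿ ∖ 0) / μₙ`. -/
def quotientMap (n : ℕ) [NeZero n] (z : punctured n) : PuncturedQuotient n := Quotient.mk'' z

theorem quotientMap_isLocalHomeomorph (n : ℕ) [NeZero n] :
    IsLocalHomeomorph (quotientMap n) :=
  (isQuotientCoveringMap_quotientMk_of_properlyDiscontinuousSMul
    (G := rootsOfUnity n ℂ) (E := punctured n)).isCoveringMap.isLocalHomeomorph

theorem quotientMap_eq_iff {n : ℕ} [NeZero n] {z w : punctured n} :
    quotientMap n z = quotientMap n w ↔ ∃ ζ : rootsOfUnity n ℂ, ζ • w = z :=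
  Quotient.eq''.trans MulAction.orbitRel_apply

theorem chart_puncturedQuotient {n : ℕ} [NeZero n]
    {e : OpenPartialHomeomorph (PuncturedQuotient n) (Cn n)}
    (he : e ∈ atlas (Cn n) (PuncturedQuotient n)) :
    (∀ y ∈ e.target, ∃ z : punctured n, (z : Cn n) = y ∧ e.symm y = quotientMap n z) ∧
    (∀ z : punctured n, (z : Cn n) ∈ e.target → e (quotientMap n z) = z) := by
  have hl := quotientMap_isLocalHomeomorph n
  obtain ⟨x, rfl⟩ : ∃ x : punctured n,
      (hl.localInverseAt x).trans (chartAt (Cn n) x) = e := by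
    obtain ⟨q, hq⟩ := he
    exact ⟨_, hq⟩
  have hsymm : ∀ y ∈ ((hl.localInverseAt x).trans (chartAt (Cn n) x)).target,
      ∃ z : punctured n, (z : Cn n) = y ∧
        ((hl.localInverseAt x).trans (chartAt (Cn n) x)).symm y = quotientMap n z := by
    intro y hy
    refine ⟨(chartAt (Cn n) x).symm y, (chartAt (Cn n) x).right_inv hy.1, ?_⟩
    exact congrFun (hl.localInverseAt_symm x) _
  refine ⟨hsymm, fun z hz => ?_⟩
  obtain ⟨w, hw, h⟩ := hsymm _ hz
  obtain rfl : w = z := Subtype.ext hw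
  rw [← h]
  exact OpenPartialHomeomorph.right_inv _ hz

theorem contDiffOn_transition_quotient {n : ℕ} [NeZero n]
    {e e' : OpenPartialHomeomorph (PuncturedQuotient n) (Cn n)}
    (he : e ∈ atlas (Cn n) (PuncturedQuotient n))
    (he' : e' ∈ atlas (Cn n) (PuncturedQuotient n)) :
    ContDiffOn ℂ ω (e.symm ≫ₕ e') (e.symm ≫ₕ e').source := by
  intro y hy
  obtain ⟨z, hzy, hz⟩ := (chart_puncturedQuotient he).1 y hy.1
  have hy' : e' (e.symm y) ∈ e'.target := e'.map_source hy.2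
  obtain ⟨w, hwy, hw⟩ := (chart_puncturedQuotient he').1 _ hy'
  have hleft : e'.symm (e' (e.symm y)) = e.symm y := e'.left_inv hy.2
  rw [hleft, hz, eq_comm, quotientMap_eq_iff] at hw
  obtain ⟨ζ, rfl⟩ := hw
  rw [coe_smul, hzy] at hwy
  have hc : Continuous fun v : Cn n => ((ζ : ℂˣ) : ℂ) • v := by fun_prop
  have hev : ∀ᶠ v in 𝓝 y, (e.symm ≫ₕ e') v = ((ζ : ℂˣ) : ℂ) • v := by
    have h1 : ∀ᶠ v in 𝓝 y, v ∈ e.target := e.open_target.mem_nhds hy.1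
    have h2 : ∀ᶠ v in 𝓝 y, ((ζ : ℂˣ) : ℂ) • v ∈ e'.target :=
      hc.continuousAt.eventually_mem (e'.open_target.mem_nhds (by simpa only [hwy] using hy'))
    filter_upwards [h1, h2] with v hv1 hv2
    obtain ⟨z', rfl, hz'⟩ := (chart_puncturedQuotient he).1 v hv1
    have : quotientMap n z' = quotientMap n (ζ • z') :=
      (quotientMap_eq_iff.2 ⟨ζ, rfl⟩).symm
    change e' (e.symm _) = _
    rw [hz', this]
    exact (chart_puncturedQuotient he').2 (ζ • z') hv2
  have hd : ContDiff ℂ ω fun v : Cn n => ((ζ : ℂˣ) : ℂ) • v := by fun_prop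
  exact (hd.contDiffAt.congr_of_eventuallyEq hev).contDiffWithinAt

instance instIsManifoldPuncturedQuotient (n : ℕ) [NeZero n] :
    IsManifold 𝓘(ℂ, Cn n) ω (PuncturedQuotient n) := by
  apply isManifold_of_contDiffOn
  intro e e' he he'
  simpa using contDiffOn_transition_quotient he he'

/-! ### The blow-down map -/

/-- The complement of the zero section in `𝒪(-n)`. -/
def offZeroSection (n : ℕ) : TopologicalSpace.Opens (OMinus n) :=
  ⟨{p | p.1.1 ≠ 0}, isOpen_ne_fun (continuous_fst.comp continuous_subtype_val) continuous_const⟩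

/-- `w` is an `n`-th root of the point `(z, [ξ])` of `𝒪(-n)`: it lies on the line `[ξ]`, and
`(wᵏ)ⁿ = zᵏ` for all `k`. -/
def IsRoot {n : ℕ} (p : OMinus n) (w : punctured n) : Prop :=
  (∀ k, (w : Cn n) k ^ n = p.1.1 k) ∧
    Projectivization.mk ℂ (w : Cn n) (punctured_ne_zero w) = p.1.2

theorem exists_isRoot {n : ℕ} [NeZero n] (p : offZeroSection n) :
    ∃ w : punctured n, IsRoot p.1 w := by
  obtain ⟨⟨⟨z, l⟩, h⟩, hz⟩ := p
  change z ≠ 0 at hz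
  obtain ⟨i, hi⟩ : ∃ i, l.rep i ≠ 0 := exists_rep_ne_zero ⟨(z, l), h⟩
  obtain ⟨t, ht⟩ := IsAlgClosed.exists_pow_nat_eq (z i / l.rep i ^ n) (NeZero.pos n)
  have key : ∀ k, (t • l.rep : Cn n) k ^ n = z k := by
    intro k
    have := h i k
    simp only [PiLp.smul_apply, smul_eq_mul, mul_pow, ht]
    field_simp
    simpa [mul_comm] using this
  have h0 : (t • l.rep : Cn n) ≠ 0 := by
    intro h0
    apply hz
    ext k
    rw [← key k, h0]
    simp [NeZero.ne n]
  refine ⟨⟨t • l.rep, h0⟩, key, ?_⟩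
  exact ((Projectivization.mk_eq_mk_iff' ℂ _ _ _ l.rep_nonzero).2 ⟨t, rfl⟩).trans l.mk_rep

/-- The blow-down map `π`, restricted to the complement of the zero section: `(z, [ξ])` is sent to
the class modulo `μₙ` of its `n`-th roots. -/
def blowDown (n : ℕ) [NeZero n] (p : offZeroSection n) : PuncturedQuotient n :=
  quotientMap n (exists_isRoot p).choose

/-- The blow-down map does not depend on the chosen root. -/
theorem blowDown_eq {n : ℕ} [NeZero n] (p : offZeroSection n) (w : punctured n)
    (hw : IsRoot p.1 w) : blowDown n p = quotientMap n w := by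
  obtain ⟨h1, h2⟩ := (exists_isRoot p).choose_spec
  rw [blowDown, quotientMap_eq_iff]
  obtain ⟨a, ha⟩ := (Projectivization.mk_eq_mk_iff ℂ _ _ _ _).1 (h2.trans hw.2.symm)
  obtain ⟨k, hk⟩ : ∃ k, (w : Cn n) k ≠ 0 := by
    by_contra! h
    exact punctured_ne_zero w (by ext k; simpa using h k)
  have hak : (a : ℂ) ^ n = 1 := by
    have e1 := h1 k
    rw [← ha, ← hw.1 k] at e1
    change ((a : ℂ) * (w : Cn n) k) ^ n = _ at e1
    rw [mul_pow] at e1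
    exact mul_right_cancel₀ (pow_ne_zero n hk) (by rw [e1, one_mul])
  exact ⟨⟨a, (mem_rootsOfUnity _ _).2 (Units.ext (by simpa using hak))⟩, Subtype.ext ha⟩

/-- The map `ℂⁿ ∖ 0 → 𝒪(-n)`, `z ↦ ((z¹)ⁿ, …, (zⁿ)ⁿ; [z])`. -/
def cover (n : ℕ) (z : punctured n) : OMinus n := OMinus.mk (z : Cn n) (punctured_ne_zero z) 1

theorem isRoot_cover {n : ℕ} (z : punctured n) : IsRoot (cover n z) z :=
  ⟨fun _ => (one_mul _).symm, rfl⟩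

theorem cover_mem {n : ℕ} [NeZero n] (z : punctured n) : cover n z ∈ offZeroSection n := by
  intro h
  apply punctured_ne_zero z
  ext k
  have := (isRoot_cover z).1 k
  rw [h] at this
  simpa [NeZero.ne n] using this

/-- `cover` is the quotient map `ℂⁿ ∖ 0 → (ℂⁿ ∖ 0) / μₙ` followed by the inverse of `π`. -/
theorem blowDown_cover {n : ℕ} [NeZero n] (z : punctured n) :
    blowDown n ⟨cover n z, cover_mem z⟩ = quotientMap n z :=
  blowDown_eq _ _ (isRoot_cover z)

/-! ### Holomorphic forms -/

section Forms

variable {n : ℕ} {M N : Type} [TopologicalSpace M] [ChartedSpace (Cn n) M]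
  [TopologicalSpace N] [ChartedSpace (Cn n) N]

/-- Fields of complex multilinear alternating `n`-forms, i.e. forms of type `(n, 0)`, on an
`n`-dimensional complex manifold, without regularity. -/
abbrev TopForm (n : ℕ) (M : Type) [TopologicalSpace M] [ChartedSpace (Cn n) M] : Type :=
  ∀ x : M, TangentSpace 𝓘(ℂ, Cn n) x [⋀^Fin n]→L[ℂ] ℂ

/-- The pullback of an `n`-form. -/
def TopForm.pullback (f : M → N) (α : TopForm n N) : TopForm n M := fun x =>
  (α (f x)).compContinuousLinearMap (mfderiv 𝓘(ℂ, Cn n) 𝓘(ℂ, Cn n) f x)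

/-- An `n`-form is holomorphic if its expression in each chart is. -/
def TopForm.IsHolomorphic (α : TopForm n M) : Prop :=
  ∀ e ∈ atlas (Cn n) M,
    DifferentiableOn ℂ (F := Cn n [⋀^Fin n]→L[ℂ] ℂ)
      (TopForm.pullback (M := Cn n) e.symm α) e.target

/-- The alternating form `dz¹ ∧ … ∧ dzⁿ`, `(v₁, …, vₙ) ↦ det (vⱼᵏ)`. -/
def dzForm (n : ℕ) : Cn n [⋀^Fin n]→L[ℂ] ℂ :=
  { (Matrix.detRowAlternating (n := Fin n) (R := ℂ)).compLinearMap
      (WithLp.linearEquiv 2 ℂ (Fin n → ℂ)).toLinearMap with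
    cont := by
      change Continuous fun v : Fin n → Cn n => Matrix.det (fun j k => v j k)
      exact Continuous.matrix_det (by fun_prop) }

theorem dzForm_apply (n : ℕ) (v : Fin n → Cn n) :
    dzForm n v = Matrix.det (Matrix.of fun j k => v j k) := rfl

/-- The form `dz¹ ∧ … ∧ dzⁿ` on the manifold `ℂⁿ`. -/
def stdForm (n : ℕ) : TopForm n (Cn n) := fun _ => dzForm n

end Forms

/-! ### The Ricci-flat metric, its Levi-Civita connection, parallel forms -/

/-- The Hermitian matrix `g_{μν̄} = (1 + aⁿ/uⁿ)^{1/n} (δ_{μν} - aⁿ/(aⁿ + uⁿ) · z̄_μ z_ν / u)`,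
`u = |z|²`, of the Calabi-Eguchi-Hanson metric with parameter `a` at `z ∈ ℂⁿ ∖ 0`. -/
def metricMatrix {n : ℕ} (a : ℝ) (z : Cn n) : Matrix (Fin n) (Fin n) ℂ := fun μ ν =>
  letI u : ℝ := ‖z‖ ^ 2
  (((1 + a ^ n / u ^ n) ^ (1 / n : ℝ) : ℝ) : ℂ) *
    ((if μ = ν then 1 else 0) -
      ((a ^ n / (a ^ n + u ^ n) : ℝ) : ℂ) * ((starRingEnd ℂ) (z μ) * z ν / (u : ℂ)))

/-- The underlying Riemannian metric `(v, w) ↦ Re ∑ g_{μν̄} v^μ w̄^ν`. -/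
def metricOnPunctured {n : ℕ} (a : ℝ) (z v w : Cn n) : ℝ :=
  (∑ μ, ∑ ν, metricMatrix a z μ ν * v μ * (starRingEnd ℂ) (w ν)).re

/-- Smooth Riemannian metrics on `𝒪(-n)`. -/
abbrev Metric (n : ℕ) : Type :=
  ContMDiffRiemannianMetric 𝓘(ℝ, Cn n) ∞ (Cn n)
    (fun x : OMinus n => TangentSpace 𝓘(ℝ, Cn n) x)

/-- `g` is the Ricci-flat Calabi-Eguchi-Hanson metric with parameter `a`: a smooth Riemannian metric
on all of `𝒪(-n)` which off the zero section, identified with `(ℂⁿ ∖ 0) / μₙ` by the blow-down map,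
is given by `metricOnPunctured a` in the standard coordinates of `ℂⁿ ∖ 0`. -/
def IsCalabiEguchiHanson {n : ℕ} (a : ℝ) (g : Metric n) : Prop :=
  ∀ (z : punctured n) (v w : TangentSpace 𝓘(ℝ, Cn n) z),
    g.inner (cover n z)
      (mfderiv 𝓘(ℝ, Cn n) 𝓘(ℝ, Cn n) (cover n) z v)
      (mfderiv 𝓘(ℝ, Cn n) 𝓘(ℝ, Cn n) (cover n) z w) = metricOnPunctured a z v w

/-- Covariant derivatives on the real tangent bundle of `𝒪(-n)`. -/
abbrev Connection (n : ℕ) : Type :=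
  CovariantDerivative 𝓘(ℝ, Cn n) (Cn n) (fun x : OMinus n => TangentSpace 𝓘(ℝ, Cn n) x)

/-- The covariant derivative `∇` is the Levi-Civita connection of `g`: it is torsion-free and
compatible with `g`. -/
def IsLeviCivita {n : ℕ} (g : Metric n) (nabla : Connection n) : Prop :=
  nabla.torsion = 0 ∧
    letI : RiemannianBundle (fun x : OMinus n => TangentSpace 𝓘(ℝ, Cn n) x) :=
      ⟨g.toRiemannianMetric⟩
    nabla.IsMetricCompatible

/-- `∇ η = 0`: one has `d(η(W₁, …, Wₙ))(v) = ∑ⱼ η(W₁, …, ∇ᵥ Wⱼ, …, Wₙ)` at each point `x`, for all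
tangent vectors `v` at `x` and all real vector fields `W₁, …, Wₙ` that are differentiable at `x`. -/
def IsParallel {n : ℕ} (nabla : Connection n) (η : TopForm n (OMinus n)) : Prop :=
  ∀ (x : OMinus n) (W : Fin n → ∀ p : OMinus n, TangentSpace 𝓘(ℝ, Cn n) p),
    (∀ j, MDifferentiableAt 𝓘(ℝ, Cn n) (𝓘(ℝ, Cn n).prod 𝓘(ℝ, Cn n))
      (fun p => (⟨p, W j p⟩ : TangentBundle 𝓘(ℝ, Cn n) (OMinus n))) x) →
    ∀ v : TangentSpace 𝓘(ℝ, Cn n) x,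
      mvfderiv 𝓘(ℝ, Cn n) (fun p => η p (fun j => W j p)) x v =
        ∑ j, η x (Function.update (fun k => W k x) j (nabla (W j) x v))

end CalabiEguchiHanson

end

noncomputable section

set_option maxSynthPendingDepth 3

namespace CalabiEguchiHanson

/-!
In a standard chart `y` of `𝒪(-n)` the covering `ℂⁿ ∖ 0 → 𝒪(-n) ∖ ℂℙⁿ⁻¹`, with fibres the
`μₙ`-orbits, has constant Jacobian determinant `n`. Hence `dz¹ ∧ … ∧ dzⁿ` is the pullback of
`n⁻¹ dy¹ ∧ … ∧ dyⁿ`, which makes sense and does not vanish on the zero section either.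

Along the decomposition of the tangent spaces into the vertical direction and its orthogonal
complement, the metric is block diagonal. In the chart its weights are built from `aⁿ + |z|²ⁿ`,
which stays smooth and positive at the zero section because `a > 0`.

On `ℂⁿ ∖ 0` the metric has constant determinant, so its Christoffel symbols are trace-free. As
the Jacobian of the covering is constant, so are those of the chart, off the zero section and
hence everywhere by continuity; this says that `η` is parallel.
-/

/-! ### Christoffel symbols of a family of inner products -/

section Christoffel

variable {E : Type*} [NormedAddCommGroup E] [NormedSpace ℝ E]

/-- The Koszul expression
`(u, v, w) ↦ (D u (v, w) + D v (u, w) - D w (u, v)) / 2` of the derivative `D` of a metric. -/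
def koszul (D : E →L[ℝ] E →L[ℝ] E →L[ℝ] ℝ) : E →L[ℝ] E →L[ℝ] E →L[ℝ] ℝ :=
  (1 / 2 : ℝ) • (D + D.flip -
    (ContinuousLinearMap.flipₗᵢ ℝ E E ℝ : (E →L[ℝ] E →L[ℝ] ℝ) →L[ℝ] (E →L[ℝ] E →L[ℝ] ℝ)).comp
      D.flip)

theorem koszul_apply (D : E →L[ℝ] E →L[ℝ] E →L[ℝ] ℝ) (u v w : E) :
    koszul D u v w = (D u v w + D v u w - D w u v) / 2 := by
  simp only [koszul, smul_apply, sub_apply, add_apply, ContinuousLinearMap.comp_apply,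
    ContinuousLinearEquiv.coe_coe, LinearIsometryEquiv.coe_toContinuousLinearEquiv,
    ContinuousLinearMap.coe_flipₗᵢ, ContinuousLinearMap.flip_apply, smul_eq_mul]
  ring

theorem koszul_comm {D : E →L[ℝ] E →L[ℝ] E →L[ℝ] ℝ} (hD : ∀ u v w, D u v w = D u w v)
    (u v : E) : koszul D u v = koszul D v u := by
  ext w
  rw [koszul_apply, koszul_apply, hD w u v, add_comm (D u v w)]

theorem koszul_add_koszul {D : E →L[ℝ] E →L[ℝ] E →L[ℝ] ℝ} (hD : ∀ u v w, D u v w = D u w v)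
    (u v w : E) : koszul D u v w + koszul D u w v = D u v w := by
  rw [koszul_apply, koszul_apply, hD u w v, hD v u w, hD w u v]
  ring

/-- The Christoffel symbols at a point of a metric with value `G` and derivative `D` there. They are
a junk value unless `G` is nondegenerate. -/
def christoffel (G : E →L[ℝ] E →L[ℝ] ℝ) (D : E →L[ℝ] E →L[ℝ] E →L[ℝ] ℝ) : E →L[ℝ] E →L[ℝ] E :=
  (ContinuousLinearMap.compL ℝ E (E →L[ℝ] ℝ) E G.inverse).comp (koszul D)

theorem christoffel_apply (G : E →L[ℝ] E →L[ℝ] ℝ) (D : E →L[ℝ] E →L[ℝ] E →L[ℝ] ℝ) (u v : E) :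
    christoffel G D u v = G.inverse (koszul D u v) := rfl

theorem christoffel_comm (G : E →L[ℝ] E →L[ℝ] ℝ) {D : E →L[ℝ] E →L[ℝ] E →L[ℝ] ℝ}
    (hD : ∀ u v w, D u v w = D u w v) (u v : E) :
    christoffel G D u v = christoffel G D v u := by
  rw [christoffel_apply, christoffel_apply, koszul_comm hD]

theorem injective_of_posDef {G : E →L[ℝ] E →L[ℝ] ℝ} (hG : ∀ v, v ≠ 0 → 0 < G v v) :
    Function.Injective G := by
  rw [injective_iff_map_eq_zero]
  intro v hv
  by_contra h
  exact (hG v h).ne' (by rw [hv, zero_apply])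

variable [FiniteDimensional ℝ E]

theorem exists_equiv_of_posDef {G : E →L[ℝ] E →L[ℝ] ℝ} (hG : ∀ v, v ≠ 0 → 0 < G v v) :
    ∃ e : E ≃L[ℝ] (E →L[ℝ] ℝ), (e : E →L[ℝ] E →L[ℝ] ℝ) = G := by
  have hrank : Module.finrank ℝ E = Module.finrank ℝ (E →L[ℝ] ℝ) := by
    rw [← (LinearMap.toContinuousLinearMap (𝕜 := ℝ) (E := E) (F' := ℝ)).finrank_eq]
    exact Subspace.dual_finrank_eq.symm
  exact ⟨(LinearEquiv.ofInjectiveOfFinrankEq (G : E →ₗ[ℝ] E →L[ℝ] ℝ) (injective_of_posDef hG)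
    hrank).toContinuousLinearEquiv, rfl⟩

theorem inner_christoffel {G : E →L[ℝ] E →L[ℝ] ℝ} (hG : ∀ v, v ≠ 0 → 0 < G v v)
    (D : E →L[ℝ] E →L[ℝ] E →L[ℝ] ℝ) (u v w : E) :
    G (christoffel G D u v) w = koszul D u v w := by
  obtain ⟨e, rfl⟩ := exists_equiv_of_posDef hG
  simp [christoffel_apply]

theorem inner_christoffel_add {G : E →L[ℝ] E →L[ℝ] ℝ} (hG : ∀ v, v ≠ 0 → 0 < G v v)
    (hs : ∀ v w, G v w = G w v) {D : E →L[ℝ] E →L[ℝ] E →L[ℝ] ℝ}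
    (hD : ∀ u v w, D u v w = D u w v) (u v w : E) :
    G (christoffel G D u v) w + G v (christoffel G D u w) = D u v w := by
  rw [hs v, inner_christoffel hG, inner_christoffel hG, koszul_add_koszul hD]

/-- Uniqueness of the Christoffel symbols. The vectors are parametrized by a surjection `A`, so that
`B` may be given in other coordinates than `G` and `D`. -/
theorem christoffel_apply_eq {ι : Type*} {G : E →L[ℝ] E →L[ℝ] ℝ}
    (hG : ∀ v, v ≠ 0 → 0 < G v v) (hs : ∀ v w, G v w = G w v) {D : E →L[ℝ] E →L[ℝ] E →L[ℝ] ℝ}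
    {A : ι → E} (hA : Function.Surjective A) {B : ι → ι → E} (hB : ∀ i j, B i j = B j i)
    (h : ∀ i j k, G (B i j) (A k) + G (A j) (B i k) = D (A i) (A j) (A k)) (i j : ι) :
    christoffel G D (A i) (A j) = B i j := by
  apply injective_of_posDef hG
  ext w
  obtain ⟨k, rfl⟩ := hA w
  rw [inner_christoffel hG, koszul_apply, ← h i j k, ← h j i k, ← h k i j, hB j i, hB k i, hB k j,
    hs (A j) (B i k)]
  ring

theorem continuousAt_christoffel {X : Type*} [TopologicalSpace X] {G : X → E →L[ℝ] E →L[ℝ] ℝ}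
    {D : X → E →L[ℝ] E →L[ℝ] E →L[ℝ] ℝ} {x : X} (hG : ContinuousAt G x) (hD : ContinuousAt D x)
    (hpos : ∀ v, v ≠ 0 → 0 < G x v v) (u v : E) :
    ContinuousAt (fun y => christoffel (G y) (D y) u v) x := by
  obtain ⟨e, he⟩ := exists_equiv_of_posDef hpos
  have hinv : ContinuousAt ContinuousLinearMap.inverse (G x) := by
    rw [← he]
    exact (contDiffAt_map_inverse (𝕜 := ℝ) (n := 0) e).continuousAt
  refine (hinv.comp hG).clm_apply (continuousAt_clm_apply.2 fun w => ?_)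
  change ContinuousAt (fun y => koszul (D y) u v w) x
  simp only [koszul_apply]
  fun_prop

end Christoffel

/-! ### The Levi-Civita connection of a Riemannian metric -/

section TangentCoordinates

variable {E : Type*} [NormedAddCommGroup E] [NormedSpace ℝ E]
  {M : Type*} [TopologicalSpace M] [ChartedSpace E M] [IsManifold 𝓘(ℝ, E) ∞ M]

/-- The tangent vectors at `p` expressed in the preferred chart at `x`. Tangent vectors at `p` are
elements of `E` via the preferred chart at `p`. -/
def tangentCoord (x p : M) : E →L[ℝ] E :=
  (trivializationAt E (TangentSpace 𝓘(ℝ, E)) x).continuousLinearMapAt ℝ p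

/-- The tangent vector at `p` with given expression in the preferred chart at `x`. -/
def tangentCoordSymm (x p : M) : E →L[ℝ] E :=
  (trivializationAt E (TangentSpace 𝓘(ℝ, E)) x).symmL ℝ p

theorem tangentCoord_tangentCoordSymm {x p : M} (hp : p ∈ (chartAt E x).source) (v : E) :
    tangentCoord x p (tangentCoordSymm x p v) = v :=
  (trivializationAt E (TangentSpace 𝓘(ℝ, E)) x).continuousLinearMapAt_symmL (R := ℝ)
    (by simpa using hp) v

theorem tangentCoordSymm_tangentCoord {x p : M} (hp : p ∈ (chartAt E x).source) (v : E) :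
    tangentCoordSymm x p (tangentCoord x p v) = v :=
  (trivializationAt E (TangentSpace 𝓘(ℝ, E)) x).symmL_continuousLinearMapAt (R := ℝ)
    (by simpa using hp) v

theorem tangentCoord_self (x : M) (v : E) : tangentCoord x x v = v := by
  have h := TangentBundle.continuousLinearMapAt_trivializationAt (I := 𝓘(ℝ, E))
    (mem_chart_source E x)
  rw [mfderiv_extChartAt_self] at h
  exact DFunLike.congr_fun h v

theorem tangentCoordSymm_self (x : M) (v : E) : tangentCoordSymm x x v = v := by
  simpa only [tangentCoord_self] using tangentCoordSymm_tangentCoord (mem_chart_source E x) v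

theorem tangentCoordSymm_eq_fderiv {x p : M} (hp : p ∈ (chartAt E x).source) :
    tangentCoordSymm x p =
      fderiv ℝ (fun y => chartAt E p ((chartAt E x).symm y)) (chartAt E x p) := by
  refine ((TangentBundle.symmL_trivializationAt_eq_core (I := 𝓘(ℝ, E)) hp).trans
    (tangentBundleCore_coordChange_achart (I := 𝓘(ℝ, E)) x p p)).trans ?_
  rw [ModelWithCorners.range_eq_univ, fderivWithin_univ]
  rfl

theorem tangentCoord_apply {x p : M} (hp : p ∈ (chartAt E x).source) (v : E) :
    tangentCoord x p v = (trivializationAt E (TangentSpace 𝓘(ℝ, E)) x ⟨p, v⟩).2 :=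
  congrFun ((trivializationAt E (TangentSpace 𝓘(ℝ, E)) x).coe_linearMapAt_of_mem (R := ℝ)
    (by simpa using hp)) v

/-- The expression of the vector field `W` in the preferred chart at `x`. -/
def fieldCoord (x : M) (W : M → E) (p : M) : E := tangentCoord x p (W p)

theorem fieldCoord_self (x : M) (W : M → E) : fieldCoord x W x = W x := tangentCoord_self x (W x)

/-- Differentiability at `x` of the vector field `W`, whose value at each point is an element of `E`
via the preferred chart there; this is not differentiability of the map `W : M → E`. -/
def DifferentiableFieldAt (W : M → E) (x : M) : Prop :=
  MDifferentiableAt 𝓘(ℝ, E) (𝓘(ℝ, E).prod 𝓘(ℝ, E))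
    (fun p => (⟨p, W p⟩ : TangentBundle 𝓘(ℝ, E) M)) x

theorem differentiableFieldAt_iff {x : M} {W : M → E} :
    DifferentiableFieldAt W x ↔ MDifferentiableAt 𝓘(ℝ, E) 𝓘(ℝ, E) (fieldCoord x W) x := by
  refine (mdifferentiableAt_section (F := E) (E := (TangentSpace 𝓘(ℝ, E) : M → Type _))
    (IB := 𝓘(ℝ, E)) W).trans ?_
  apply Filter.EventuallyEq.mdifferentiableAt_iff
  filter_upwards [chart_source_mem_nhds E x] with p hp
  exact (tangentCoord_apply hp (W p)).symm

end TangentCoordinates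

section Charts

variable {𝕜 E F : Type*} [NontriviallyNormedField 𝕜] [NormedAddCommGroup E] [NormedSpace 𝕜 E]
  [NormedAddCommGroup F] [NormedSpace 𝕜 F] {M N : Type*} [TopologicalSpace M] [ChartedSpace E M]
  [TopologicalSpace N] [ChartedSpace F N] {f : M → N} {x : M}

theorem hasMFDerivAt_iff_hasFDerivAt_chartAt {f' : E →L[𝕜] F} :
    HasMFDerivAt 𝓘(𝕜, E) 𝓘(𝕜, F) f x f' ↔ ContinuousAt f x ∧
      HasFDerivAt (chartAt F (f x) ∘ f ∘ (chartAt E x).symm) f' (chartAt E x x) := by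
  have h : HasMFDerivAt 𝓘(𝕜, E) 𝓘(𝕜, F) f x f' ↔ ContinuousAt f x ∧
      HasFDerivWithinAt (chartAt F (f x) ∘ f ∘ (chartAt E x).symm) f' (Set.range 𝓘(𝕜, E))
        (chartAt E x x) := Iff.rfl
  rw [h, ModelWithCorners.range_eq_univ, hasFDerivWithinAt_univ]

theorem hasMFDerivAt_of_chartAt_eventuallyEq {f₀ : E → F} {f' : E →L[𝕜] F}
    (hf : ContinuousAt f x) (h : ∀ᶠ p in 𝓝 x, chartAt F (f x) (f p) = f₀ (chartAt E x p))
    (h' : HasFDerivAt f₀ f' (chartAt E x x)) : HasMFDerivAt 𝓘(𝕜, E) 𝓘(𝕜, F) f x f' := by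
  refine hasMFDerivAt_iff_hasFDerivAt_chartAt.2 ⟨hf, h'.congr_of_eventuallyEq ?_⟩
  have hsymm := ((chartAt E x).tendsto_symm (mem_chart_source E x)).eventually h
  filter_upwards [hsymm, chart_target_mem_nhds E x] with y hy hyt
  rw [Function.comp_apply, Function.comp_apply, hy, (chartAt E x).right_inv hyt]

end Charts

section DerivAt

variable {E F : Type*} [NormedAddCommGroup E] [NormedSpace ℝ E]
  [NormedAddCommGroup F] [NormedSpace ℝ F] {M : Type*} [TopologicalSpace M] [ChartedSpace E M]

theorem hasMFDerivAt_iff_comp_chartAt_symm {f : M → F} {x : M} {L : E →L[ℝ] F} :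
    HasMFDerivAt 𝓘(ℝ, E) 𝓘(ℝ, F) f x L ↔
      HasFDerivAt (f ∘ (chartAt E x).symm) L (chartAt E x x) :=
  hasMFDerivAt_iff_hasFDerivAt_chartAt.trans <| and_iff_right_of_imp fun hL =>
    ((chartAt E x).symm.continuousAt_iff_continuousAt_comp_right (mem_chart_source E x)).2
      hL.continuousAt

/-- The derivative at `x` of a function with values in a normed space, as a linear map on the model
space `E`. -/
def derivAt (f : M → F) (x : M) : E →L[ℝ] F := mvfderiv 𝓘(ℝ, E) f x

variable {f f' : M → F} {x : M}

theorem hasFDerivAt_comp_chartAt_symm (hf : MDifferentiableAt 𝓘(ℝ, E) 𝓘(ℝ, F) f x) :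
    HasFDerivAt (f ∘ (chartAt E x).symm) (derivAt f x) (chartAt E x x) :=
  hasMFDerivAt_iff_comp_chartAt_symm.1 hf.hasMFDerivAt

theorem derivAt_eq_of_hasFDerivAt {L : E →L[ℝ] F}
    (h : HasFDerivAt (f ∘ (chartAt E x).symm) L (chartAt E x x)) : derivAt f x = L :=
  (hasMFDerivAt_iff_comp_chartAt_symm.2 h).mfderiv

theorem derivAt_congr (h : f =ᶠ[𝓝 x] f') : derivAt f x = (derivAt f' x : E →L[ℝ] F) := by
  ext v
  exact DFunLike.congr_fun (h.mfderiv_eq (I := 𝓘(ℝ, E)) (I' := 𝓘(ℝ, F))) v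

end DerivAt

section LeviCivita

variable {E : Type*} [NormedAddCommGroup E] [NormedSpace ℝ E]
  {M : Type*} [TopologicalSpace M] [ChartedSpace E M] [IsManifold 𝓘(ℝ, E) ∞ M]

/-- Smooth Riemannian metrics on the manifold `M`. -/
abbrev TangentMetric (E M : Type*) [NormedAddCommGroup E] [NormedSpace ℝ E]
    [TopologicalSpace M] [ChartedSpace E M] [IsManifold 𝓘(ℝ, E) ∞ M] :=
  ContMDiffRiemannianMetric 𝓘(ℝ, E) ∞ E (fun x : M => TangentSpace 𝓘(ℝ, E) x)

/-- The inner product on the tangent space at `p`, as a bilinear form on the model space `E`. -/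
def metricAt (g : TangentMetric E M) (p : M) : E →L[ℝ] E →L[ℝ] ℝ := g.inner p

/-- The expression of the metric in the preferred chart at `x`. -/
def metricCoord (g : TangentMetric E M) (x p : M) : E →L[ℝ] E →L[ℝ] ℝ :=
  (metricAt g p).bilinearComp (tangentCoordSymm x p) (tangentCoordSymm x p)

theorem metricCoord_apply (g : TangentMetric E M) (x p : M) (v w : E) :
    metricCoord g x p v w = metricAt g p (tangentCoordSymm x p v) (tangentCoordSymm x p w) := rfl

theorem metricCoord_self (g : TangentMetric E M) (x : M) : metricCoord g x x = metricAt g x := by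
  ext v w
  rw [metricCoord_apply, tangentCoordSymm_self, tangentCoordSymm_self]

theorem metricAt_symm (g : TangentMetric E M) (p : M) (v w : E) :
    metricAt g p v w = metricAt g p w v := g.symm p v w

theorem metricAt_pos (g : TangentMetric E M) (p : M) (v : E) (hv : v ≠ 0) :
    0 < metricAt g p v v := g.pos p v hv

theorem metricCoord_tangentCoord (g : TangentMetric E M) {x p : M}
    (hp : p ∈ (chartAt E x).source) (v w : E) :
    metricCoord g x p (tangentCoord x p v) (tangentCoord x p w) = metricAt g p v w := by
  rw [metricCoord_apply, tangentCoordSymm_tangentCoord hp, tangentCoordSymm_tangentCoord hp]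

theorem trivializationAt_bilinearForm_apply {x p : M} (hp : p ∈ (chartAt E x).source)
    (B : E →L[ℝ] E →L[ℝ] ℝ) (v w : E) :
    (trivializationAt (E →L[ℝ] E →L[ℝ] ℝ)
      (fun p : M => TangentSpace 𝓘(ℝ, E) p →L[ℝ] TangentSpace 𝓘(ℝ, E) p →L[ℝ] ℝ) x ⟨p, B⟩).2 v w =
     B (tangentCoordSymm x p v) (tangentCoordSymm x p w) := by
  rw [hom_trivializationAt_apply, ContinuousLinearMap.inCoordinates]
  simp only [ContinuousLinearMap.comp_apply]
  rw [Trivialization.continuousLinearMapAt_apply, Trivialization.linearMapAt_apply,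
    if_pos (by simpa using hp), hom_trivializationAt_apply, ContinuousLinearMap.inCoordinates]
  simp only [ContinuousLinearMap.comp_apply]
  rw [Trivialization.continuousLinearMapAt_apply, Trivialization.linearMapAt_apply,
    if_pos (by simp)]
  rfl

theorem contMDiffAt_metricCoord (g : TangentMetric E M) {x p : M}
    (hp : p ∈ (chartAt E x).source) :
    ContMDiffAt 𝓘(ℝ, E) 𝓘(ℝ, E →L[ℝ] E →L[ℝ] ℝ) ∞ (metricCoord g x) p := by
  have h := (Trivialization.contMDiffAt_section_iff (IB := 𝓘(ℝ, E)) (n := ∞) (s := g.inner)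
    (e := trivializationAt (E →L[ℝ] E →L[ℝ] ℝ) _ x) (x₀ := p) (by simpa using hp)).1
    (g.contMDiff p)
  refine h.congr_of_eventuallyEq ?_
  filter_upwards [(chartAt E x).open_source.mem_nhds hp] with q hq
  ext v w
  exact (trivializationAt_bilinearForm_apply hq (metricAt g q) v w).symm

/-- The derivative of the metric at `x`, in the preferred chart at `x`. -/
def metricCoordDeriv (g : TangentMetric E M) (x : M) : E →L[ℝ] E →L[ℝ] E →L[ℝ] ℝ :=
  derivAt (metricCoord g x) x

/-- The derivative at `x` of a vector field, in the preferred chart at `x`. -/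
def fieldCoordDeriv (x : M) (W : M → E) : E →L[ℝ] E := derivAt (fieldCoord x W) x

theorem hasFDerivAt_metricCoord (g : TangentMetric E M) (x : M) :
    HasFDerivAt (fun y => metricCoord g x ((chartAt E x).symm y)) (metricCoordDeriv g x)
      (chartAt E x x) :=
  hasFDerivAt_comp_chartAt_symm
    ((contMDiffAt_metricCoord g (mem_chart_source E x)).mdifferentiableAt (by simp))

theorem hasFDerivAt_fieldCoord {x : M} {W : M → E} (hW : DifferentiableFieldAt W x) :
    HasFDerivAt (fun y => fieldCoord x W ((chartAt E x).symm y)) (fieldCoordDeriv x W)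
      (chartAt E x x) :=
  hasFDerivAt_comp_chartAt_symm (differentiableFieldAt_iff.1 hW)

theorem fieldCoordDeriv_add {x : M} {V W : M → E} (hV : DifferentiableFieldAt V x)
    (hW : DifferentiableFieldAt W x) :
    fieldCoordDeriv x (V + W) = fieldCoordDeriv x V + fieldCoordDeriv x W := by
  apply derivAt_eq_of_hasFDerivAt
  refine ((hasFDerivAt_fieldCoord hV).add (hasFDerivAt_fieldCoord hW)).congr_of_eventuallyEq ?_
  exact .of_forall fun y => map_add (tangentCoord x _) (V _) (W _)

theorem fieldCoordDeriv_smul {x : M} {f : M → ℝ} {W : M → E}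
    (hf : MDifferentiableAt 𝓘(ℝ, E) 𝓘(ℝ, ℝ) f x) (hW : DifferentiableFieldAt W x) :
    fieldCoordDeriv x (f • W) = f x • fieldCoordDeriv x W + (derivAt f x).smulRight (W x) := by
  apply derivAt_eq_of_hasFDerivAt
  have h := (hasFDerivAt_comp_chartAt_symm hf).smul (hasFDerivAt_fieldCoord hW)
  simp only [Function.comp_apply, (chartAt E x).left_inv (mem_chart_source E x),
    fieldCoord_self] at h
  exact h.congr_of_eventuallyEq (.of_forall fun y => map_smul (tangentCoord x _) (f _) (W _))

theorem metricCoordDeriv_symm (g : TangentMetric E M) (x : M) (u v w : E) :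
    metricCoordDeriv g x u v w = metricCoordDeriv g x u w v := by
  have h := hasFDerivAt_metricCoord g x
  have hvw := (h.clm_apply (hasFDerivAt_const v _)).clm_apply (hasFDerivAt_const w _)
  have hwv := (h.clm_apply (hasFDerivAt_const w _)).clm_apply (hasFDerivAt_const v _)
  simpa using DFunLike.congr_fun (hvw.unique (hwv.congr_of_eventuallyEq
    (.of_forall fun y => metricAt_symm g _ _ _))) u

theorem derivAt_metric (g : TangentMetric E M) {x : M} {V W : M → E}
    (hV : DifferentiableFieldAt V x) (hW : DifferentiableFieldAt W x) (u : E) :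
    derivAt (fun p => metricAt g p (V p) (W p)) x u =
      metricCoordDeriv g x u (V x) (W x) + metricAt g x (fieldCoordDeriv x V u) (W x) +
        metricAt g x (V x) (fieldCoordDeriv x W u) := by
  have hcoord : (fun p => metricAt g p (V p) (W p)) =ᶠ[𝓝 x]
      fun p => metricCoord g x p (fieldCoord x V p) (fieldCoord x W p) := by
    filter_upwards [chart_source_mem_nhds E x] with p hp
    exact (metricCoord_tangentCoord g hp _ _).symm
  rw [derivAt_congr hcoord, derivAt_eq_of_hasFDerivAt
    (((hasFDerivAt_metricCoord g x).clm_apply (hasFDerivAt_fieldCoord hV)).clm_apply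
      (hasFDerivAt_fieldCoord hW))]
  simp only [mem_chart_source, OpenPartialHomeomorph.left_inv, metricCoord_self, fieldCoord_self,
    ContinuousLinearMap.flip_add, add_apply, ContinuousLinearMap.comp_apply,
    ContinuousLinearMap.flip_apply]
  ring

/-- The vector field `W` on `M` pulled back to `E` by the inverse of the preferred chart at `x`. -/
def pullField (x : M) (W : ∀ p : M, TangentSpace 𝓘(ℝ, E) p) (y : E) : E :=
  VectorField.mpullbackWithin 𝓘(ℝ, E) 𝓘(ℝ, E) (extChartAt 𝓘(ℝ, E) x).symm W
    (Set.range 𝓘(ℝ, E)) y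

theorem mlieBracket_eq_lieBracket (x : M) (V W : ∀ p : M, TangentSpace 𝓘(ℝ, E) p) :
    VectorField.mlieBracket 𝓘(ℝ, E) V W x =
      VectorField.lieBracket ℝ (pullField x V) (pullField x W) (chartAt E x x) := by
  rw [← VectorField.mlieBracketWithin_univ, VectorField.mlieBracketWithin_apply,
    mfderiv_extChartAt_self]
  have huniv : (extChartAt 𝓘(ℝ, E) x).symm ⁻¹' Set.univ ∩ Set.range 𝓘(ℝ, E) = Set.univ := by simp
  have hx : extChartAt 𝓘(ℝ, E) x x = chartAt E x x := by simp
  rw [huniv, hx]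
  refine (DFunLike.congr_fun (ContinuousLinearMap.inverse_id (R := ℝ) (M := E)) _).trans ?_
  exact congrFun VectorField.lieBracketWithin_univ _

theorem inverse_tangentCoordSymm {x p : M} (hp : p ∈ (chartAt E x).source) :
    (tangentCoordSymm x p).inverse = (tangentCoord x p : E →L[ℝ] E) :=
  ContinuousLinearMap.inverse_eq
    (ContinuousLinearMap.ext fun v => tangentCoordSymm_tangentCoord (x := x) hp v)
    (ContinuousLinearMap.ext fun v => tangentCoord_tangentCoordSymm (x := x) hp v)

theorem pullField_eventuallyEq (x : M) (W : M → E) :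
    pullField x W =ᶠ[𝓝 (chartAt E x x)] fun y => fieldCoord x W ((chartAt E x).symm y) := by
  filter_upwards [chart_target_mem_nhds E x] with y hy
  have hp : (chartAt E x).symm y ∈ (chartAt E x).source := (chartAt E x).map_target hy
  have h := TangentBundle.symmL_trivializationAt (I := 𝓘(ℝ, E)) hp
  rw [show extChartAt 𝓘(ℝ, E) x ((chartAt E x).symm y) = y by
    simpa using (chartAt E x).right_inv hy] at h
  rw [fieldCoord, ← inverse_tangentCoordSymm hp]
  exact (DFunLike.congr_fun (congrArg ContinuousLinearMap.inverse h) (W _)).symm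

theorem mlieBracket_eq {x : M} {V W : M → E} (hV : DifferentiableFieldAt V x)
    (hW : DifferentiableFieldAt W x) :
    VectorField.mlieBracket 𝓘(ℝ, E) (M := M) V W x =
      fieldCoordDeriv x W (V x) - fieldCoordDeriv x V (W x) := by
  refine (mlieBracket_eq_lieBracket x V W).trans ?_
  have eqV := pullField_eventuallyEq x V
  have eqW := pullField_eventuallyEq x W
  rw [VectorField.lieBracket, ((hasFDerivAt_fieldCoord hV).congr_of_eventuallyEq eqV).fderiv,
    ((hasFDerivAt_fieldCoord hW).congr_of_eventuallyEq eqW).fderiv, eqV.self_of_nhds,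
    eqW.self_of_nhds]
  simp only [(chartAt E x).left_inv (mem_chart_source E x), fieldCoord_self]
  rfl

/-- The Christoffel symbols of `g` at `x` in the preferred chart at `x`. -/
def christoffelAt (g : TangentMetric E M) (x : M) : E →L[ℝ] E →L[ℝ] E :=
  christoffel (metricAt g x) (metricCoordDeriv g x)

/-- The covariant derivative `∇ᵤ W = d W (u) + Γ (u, W)`, computed at each point in the preferred
chart there. -/
def covDeriv (g : TangentMetric E M) (W : M → E) (x : M) : E →L[ℝ] E :=
  fieldCoordDeriv x W + (christoffelAt g x).flip (W x)

theorem covDeriv_apply (g : TangentMetric E M) (W : M → E) (x : M) (u : E) :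
    covDeriv g W x u = fieldCoordDeriv x W u + christoffelAt g x u (W x) := rfl

theorem covDeriv_add (g : TangentMetric E M) {V W : M → E} {x : M}
    (hV : DifferentiableFieldAt V x) (hW : DifferentiableFieldAt W x) :
    covDeriv g (V + W) x = covDeriv g V x + covDeriv g W x := by
  rw [covDeriv, covDeriv, covDeriv, fieldCoordDeriv_add hV hW, Pi.add_apply, map_add]
  abel

theorem covDeriv_smul (g : TangentMetric E M) {f : M → ℝ} {W : M → E} {x : M}
    (hf : MDifferentiableAt 𝓘(ℝ, E) 𝓘(ℝ, ℝ) f x) (hW : DifferentiableFieldAt W x) :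
    covDeriv g (f • W) x = f x • covDeriv g W x + (derivAt f x).smulRight (W x) := by
  rw [covDeriv, covDeriv, fieldCoordDeriv_smul hf hW, Pi.smul_apply', map_smul, smul_add]
  abel

theorem covDeriv_sub_covDeriv (g : TangentMetric E M) {x : M} {V W : M → E}
    (hV : DifferentiableFieldAt V x) (hW : DifferentiableFieldAt W x) :
    covDeriv g W x (V x) - covDeriv g V x (W x) =
      VectorField.mlieBracket 𝓘(ℝ, E) (M := M) V W x := by
  refine Eq.trans ?_ (mlieBracket_eq hV hW).symm
  rw [covDeriv_apply, covDeriv_apply, christoffelAt,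
    christoffel_comm _ (metricCoordDeriv_symm g x) (V x)]
  abel

variable [FiniteDimensional ℝ E]

theorem derivAt_metric_eq_covDeriv (g : TangentMetric E M) {x : M} {V W : M → E}
    (hV : DifferentiableFieldAt V x) (hW : DifferentiableFieldAt W x) (u : E) :
    derivAt (fun p => metricAt g p (V p) (W p)) x u =
      metricAt g x (covDeriv g V x u) (W x) + metricAt g x (V x) (covDeriv g W x u) := by
  rw [derivAt_metric g hV hW, ← inner_christoffel_add (metricAt_pos g x) (metricAt_symm g x)
    (metricCoordDeriv_symm g x), covDeriv_apply, covDeriv_apply, christoffelAt, map_add, map_add,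
    add_apply]
  abel

/-- The Levi-Civita connection of `g`. -/
def leviCivita (g : TangentMetric E M) :
    CovariantDerivative 𝓘(ℝ, E) E (fun x : M => TangentSpace 𝓘(ℝ, E) x) where
  toFun W x := (covDeriv (E := E) g W x : E →L[ℝ] E)
  isCovariantDerivativeOnUniv :=
    { add := fun hV hW _ => covDeriv_add (E := E) g hV hW
      leibniz := fun hW hf _ => covDeriv_smul (E := E) g hf hW }

/-- `nabla` is the Levi-Civita connection of `g`: it is torsion-free and compatible with `g`. This
is `IsLeviCivita` on a general manifold. -/
def IsLeviCivitaOf (g : TangentMetric E M)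
    (nabla : CovariantDerivative 𝓘(ℝ, E) E (fun x : M => TangentSpace 𝓘(ℝ, E) x)) : Prop :=
  nabla.torsion = 0 ∧
    letI : RiemannianBundle (fun x : M => TangentSpace 𝓘(ℝ, E) x) := ⟨g.toRiemannianMetric⟩
    nabla.IsMetricCompatible (V := fun x : M => TangentSpace 𝓘(ℝ, E) x)

theorem isLeviCivitaOf_leviCivita (g : TangentMetric E M) : IsLeviCivitaOf g (leviCivita g) := by
  refine ⟨(CovariantDerivative.torsion_eq_zero_iff _).2 fun hV hW =>
    covDeriv_sub_covDeriv (E := E) g hV hW, ?_⟩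
  let : RiemannianBundle (fun x : M => TangentSpace 𝓘(ℝ, E) x) := ⟨g.toRiemannianMetric⟩
  rw [CovariantDerivative.isMetricCompatible_iff (V := fun x : M => TangentSpace 𝓘(ℝ, E) x)]
  intro x X V W _ hV hW
  exact derivAt_metric_eq_covDeriv (E := E) g hV hW (X x)

section Uniqueness

variable {g : TangentMetric E M}
  {nabla : CovariantDerivative 𝓘(ℝ, E) E (fun x : M => TangentSpace 𝓘(ℝ, E) x)} {x : M}

theorem IsLeviCivitaOf.sub_eq_mlieBracket (h : IsLeviCivitaOf g nabla)
    {V W : ∀ p : M, TangentSpace 𝓘(ℝ, E) p} (hV : DifferentiableFieldAt (E := E) V x)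
    (hW : DifferentiableFieldAt (E := E) W x) :
    nabla W x (V x) - nabla V x (W x) = VectorField.mlieBracket 𝓘(ℝ, E) V W x :=
  (CovariantDerivative.torsion_eq_zero_iff nabla).1 h.1 hV hW

theorem IsLeviCivitaOf.derivAt_metric (h : IsLeviCivitaOf g nabla)
    {V W : ∀ p : M, TangentSpace 𝓘(ℝ, E) p} (hV : DifferentiableFieldAt (E := E) V x)
    (hW : DifferentiableFieldAt (E := E) W x) (u : TangentSpace 𝓘(ℝ, E) x) :
    derivAt (E := E) (fun p => metricAt g p (V p) (W p)) x u =
      metricAt g x (nabla V x u) (W x) + metricAt g x (V x) (nabla W x u) := by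
  let : RiemannianBundle (fun x : M => TangentSpace 𝓘(ℝ, E) x) := ⟨g.toRiemannianMetric⟩
  have hg : nabla.IsMetricCompatible (V := fun x : M => TangentSpace 𝓘(ℝ, E) x) := h.2
  have hcompat := hg.mvfderiv_inner_eq (V := fun x : M => TangentSpace 𝓘(ℝ, E) x)
    (FiberBundle.extend E u) hV hW
  simp only [FiberBundle.extend_apply_self] at hcompat
  exact hcompat

theorem IsLeviCivitaOf.apply_extend (h : IsLeviCivitaOf g nabla) (v : TangentSpace 𝓘(ℝ, E) x) :
    nabla (FiberBundle.extend E v) x = leviCivita g (FiberBundle.extend E v) x := by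
  let ext (v : E) : ∀ p : M, TangentSpace 𝓘(ℝ, E) p :=
    FiberBundle.extend E (show TangentSpace 𝓘(ℝ, E) x from v)
  have ext_self (v : E) : ext v x = v :=
    FiberBundle.extend_apply_self (F := E) (show TangentSpace 𝓘(ℝ, E) x from v)
  have hext (v : E) : DifferentiableFieldAt (E := E) (ext v) x :=
    FiberBundle.mdifferentiableAt_extend ..
  let nablaExt (u v : E) : E := nabla (ext v) x u
  have hΓ (u v : E) : christoffelAt g x u v = nablaExt u v - fieldCoordDeriv x (ext v) u := by
    refine christoffel_apply_eq (metricAt_pos g x) (metricAt_symm g x)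
      Function.surjective_id (B := fun u v => nablaExt u v - fieldCoordDeriv x (ext v) u)
      (fun u v => ?_) (fun u v w => ?_) u v
    · have htorsion :=
        (h.sub_eq_mlieBracket (hext u) (hext v)).trans (mlieBracket_eq (hext u) (hext v))
      rw [ext_self, ext_self] at htorsion
      exact sub_eq_sub_iff_sub_eq_sub.2 htorsion
    · have hmetric := (h.derivAt_metric (hext v) (hext w) u).symm.trans
        (CalabiEguchiHanson.derivAt_metric g (hext v) (hext w) u)
      simp only [ext_self, map_sub, sub_apply, id] at hmetric ⊢
      linear_combination hmetric
  ext u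
  refine (eq_add_of_sub_eq' (hΓ u v).symm).trans ?_
  exact congrArg (fun w => fieldCoordDeriv x (ext v) u + christoffelAt g x u w) (ext_self v).symm

theorem IsLeviCivitaOf.apply_eq (h : IsLeviCivitaOf g nabla)
    {W : ∀ p : M, TangentSpace 𝓘(ℝ, E) p} (hW : DifferentiableFieldAt (E := E) W x) :
    nabla W x = leviCivita g W x := by
  have hdiff {V : ∀ p : M, TangentSpace 𝓘(ℝ, E) p} (hV : DifferentiableFieldAt (E := E) V x) :=
    IsCovariantDerivativeOn.difference_apply nabla.isCovariantDerivativeOnUniv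
      (leviCivita g).isCovariantDerivativeOnUniv (Set.mem_univ x) hV
  have hext := hdiff (FiberBundle.mdifferentiableAt_extend 𝓘(ℝ, E) E (W x))
  rw [FiberBundle.extend_apply_self, h.apply_extend, sub_self] at hext
  exact sub_eq_zero.1 ((hdiff hW).symm.trans hext)

end Uniqueness

end LeviCivita

/-! ### Holomorphic maps and pullbacks of forms -/

section Charts

variable {𝕜 E : Type*} [NontriviallyNormedField 𝕜] [NormedAddCommGroup E] [NormedSpace 𝕜 E]
  {M N P : Type*} [TopologicalSpace M] [ChartedSpace E M] [TopologicalSpace N] [ChartedSpace E N]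
  [TopologicalSpace P] [ChartedSpace E P] {f : M → N} {x : M}

theorem hasMFDerivAt_subtype_val {U : TopologicalSpace.Opens M} (p : U) :
    HasMFDerivAt 𝓘(𝕜, E) 𝓘(𝕜, E) (Subtype.val : U → M) p (ContinuousLinearMap.id 𝕜 E) :=
  hasMFDerivAt_of_chartAt_eventuallyEq continuous_subtype_val.continuousAt
    (.of_forall fun _ => rfl) (hasFDerivAt_id _)

theorem hasMFDerivAt_codRestrict {U : TopologicalSpace.Opens N} {f' : E →L[𝕜] E}
    (hf : HasMFDerivAt 𝓘(𝕜, E) 𝓘(𝕜, E) f x f') (hU : ∀ p, f p ∈ U) :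
    HasMFDerivAt 𝓘(𝕜, E) 𝓘(𝕜, E) (fun p => (⟨f p, hU p⟩ : U)) x f' := by
  rw [hasMFDerivAt_iff_hasFDerivAt_chartAt] at hf ⊢
  exact ⟨Topology.IsInducing.subtypeVal.continuousAt_iff.2 hf.1, hf.2⟩

section InverseFunction

variable [CompleteSpace E] {f₀ : E → E} {f' : E ≃L[𝕜] E}

theorem exists_mdifferentiableAt_rightInverse (hf : ContinuousAt f x)
    (h : ∀ᶠ p in 𝓝 x, chartAt E (f x) (f p) = f₀ (chartAt E x p))
    (h' : HasStrictFDerivAt f₀ (f' : E →L[𝕜] E) (chartAt E x x)) :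
    ∃ s : N → M, s (f x) = x ∧ MDifferentiableAt 𝓘(𝕜, E) 𝓘(𝕜, E) s (f x) ∧
      ∀ᶠ q in 𝓝 (f x), f (s q) = q := by
  let s₀ : E → E := h'.localInverse f₀ f' (chartAt E x x)
  let s : N → M := fun q => (chartAt E x).symm (s₀ (chartAt E (f x) q))
  have hfx : chartAt E (f x) (f x) = f₀ (chartAt E x x) := h.self_of_nhds
  have hs₀ : s₀ (chartAt E (f x) (f x)) = chartAt E x x := by
    rw [hfx]; exact h'.localInverse_apply_image
  have hs : s (f x) = x := by
    simp only [s, hs₀, (chartAt E x).left_inv (mem_chart_source E x)]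
  have hchart : ContinuousAt (chartAt E (f x)) (f x) :=
    (chartAt E (f x)).continuousAt (mem_chart_source E (f x))
  have hs₀_cont : ContinuousAt (fun q => s₀ (chartAt E (f x) q)) (f x) :=
    ContinuousAt.comp (g := s₀) (by rw [hfx]; exact h'.localInverse_continuousAt) hchart
  have hs_cont : ContinuousAt s (f x) := by
    refine ContinuousAt.comp (g := (chartAt E x).symm) ?_ hs₀_cont
    rw [hs₀]
    exact (chartAt E x).continuousAt_symm (mem_chart_target E x)
  have hs_chart : ∀ᶠ q in 𝓝 (f x), chartAt E x (s q) = s₀ (chartAt E (f x) q) := by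
    have htarget := hs₀_cont.eventually_mem (by rw [hs₀]; exact chart_target_mem_nhds E x)
    filter_upwards [htarget] with q hq using (chartAt E x).right_inv hq
  refine ⟨s, hs, HasMFDerivAt.mdifferentiableAt (hasMFDerivAt_of_chartAt_eventuallyEq
    (f₀ := s₀) (f' := f'.symm) hs_cont (by rwa [hs]) (by rw [hfx]; exact
      h'.to_localInverse.hasFDerivAt)), ?_⟩
  have hf_cont : ContinuousAt (fun q => f (s q)) (f x) :=
    ContinuousAt.comp (g := f) (by rwa [hs]) hs_cont
  filter_upwards [hs_chart, hs_cont.eventually (by rwa [hs]),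
    hf_cont.eventually_mem (by rw [hs]; exact chart_source_mem_nhds E (f x)),
    chart_source_mem_nhds E (f x), hchart.eventually (by rw [hfx]; exact
      h'.eventually_right_inverse)] with q hq hq' hfq hqs hq_inv
  refine (chartAt E (f x)).injOn hfq hqs ?_
  rw [hq', hq]
  exact hq_inv

theorem mdifferentiableAt_of_comp {g : N → P} (hf : ContinuousAt f x)
    (h : ∀ᶠ p in 𝓝 x, chartAt E (f x) (f p) = f₀ (chartAt E x p))
    (h' : HasStrictFDerivAt f₀ (f' : E →L[𝕜] E) (chartAt E x x))
    (hg : MDifferentiableAt 𝓘(𝕜, E) 𝓘(𝕜, E) (g ∘ f) x) :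
    MDifferentiableAt 𝓘(𝕜, E) 𝓘(𝕜, E) g (f x) := by
  obtain ⟨s, hs, hs_diff, hs_inv⟩ := exists_mdifferentiableAt_rightInverse hf h h'
  rw [← hs] at hg
  refine (hg.comp (f x) hs_diff).congr_of_eventuallyEq ?_
  filter_upwards [hs_inv] with q hq
  simp only [Function.comp_apply, hq]

end InverseFunction

end Charts

section Pullback

variable {n : ℕ} {M N P : Type} [TopologicalSpace M] [ChartedSpace (Cn n) M]
  [TopologicalSpace N] [ChartedSpace (Cn n) N] [TopologicalSpace P] [ChartedSpace (Cn n) P]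
  {f : M → N} {x : M}

theorem TopForm.pullback_apply_of_hasMFDerivAt (α : TopForm n N) {f' : Cn n →L[ℂ] Cn n}
    (hf : HasMFDerivAt 𝓘(ℂ, Cn n) 𝓘(ℂ, Cn n) f x f')
    (v : Fin n → TangentSpace 𝓘(ℂ, Cn n) x) :
    α.pullback f x v = α (f x) (fun j => f' (v j)) := by
  rw [TopForm.pullback, hf.mfderiv]
  rfl

theorem TopForm.pullback_comp_apply (α : TopForm n P) {g : N → P}
    (hg : MDifferentiableAt 𝓘(ℂ, Cn n) 𝓘(ℂ, Cn n) g (f x))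
    (hf : MDifferentiableAt 𝓘(ℂ, Cn n) 𝓘(ℂ, Cn n) f x) :
    α.pullback (g ∘ f) x = (α.pullback g).pullback f x := by
  rw [TopForm.pullback, mfderiv_comp x hg hf]
  rfl

theorem TopForm.pullback_congr (α : TopForm n N) {g : M → N} (h : f =ᶠ[𝓝 x] g) :
    α.pullback f x = α.pullback g x := by
  ext v
  change α (f x) (fun j => mfderiv 𝓘(ℂ, Cn n) 𝓘(ℂ, Cn n) f x (v j)) =
    α (g x) (fun j => mfderiv 𝓘(ℂ, Cn n) 𝓘(ℂ, Cn n) g x (v j))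
  rw [h.mfderiv_eq, h.self_of_nhds]

theorem TopForm.eq_of_pullback_eq {α β : TopForm n N} {f' : Cn n →L[ℂ] Cn n}
    (hf : HasMFDerivAt 𝓘(ℂ, Cn n) 𝓘(ℂ, Cn n) f x f') (hsurj : Function.Surjective f')
    (h : α.pullback f x = β.pullback f x) : α (f x) = β (f x) := by
  ext v
  choose w hw using fun j => hsurj (v j)
  obtain rfl : (fun j => f' (w j)) = v := funext hw
  exact (α.pullback_apply_of_hasMFDerivAt hf w).symm.trans
    ((DFunLike.congr_fun h w).trans (β.pullback_apply_of_hasMFDerivAt hf w))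

end Pullback

/-! ### The form `dz¹ ∧ … ∧ dzⁿ` -/

section DzForm

variable {n : ℕ}

theorem dzForm_ne_zero (n : ℕ) : dzForm n ≠ 0 := by
  intro h
  have hone : dzForm n (fun j => EuclideanSpace.single j 1) = 1 := by
    rw [dzForm_apply]
    convert Matrix.det_one (n := Fin n) (R := ℂ)
    ext j k
    simp [Matrix.one_apply, eq_comm, PiLp.single_apply]
  simp [h] at hone

theorem dzForm_smul (ζ : ℂ) (v : Fin n → Cn n) :
    dzForm n (fun j => ζ • v j) = ζ ^ n * dzForm n v := by
  simpa using (dzForm n).map_smul_univ (fun _ => ζ) v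

theorem dzForm_vecMul (B : Matrix (Fin n) (Fin n) ℂ) {v w : Fin n → Cn n}
    (h : ∀ j, WithLp.ofLp (w j) = Matrix.vecMul (v j) B) : dzForm n w = dzForm n v * B.det := by
  rw [dzForm_apply, dzForm_apply, ← Matrix.det_mul]
  congr 1
  ext j k
  exact congrFun (h j) k

end DzForm

/-! ### The covering `ℂⁿ ∖ 0 → 𝒪(-n) ∖ ℂℙⁿ⁻¹` in the standard charts -/

section CoverChart

variable {n : ℕ} {i : Fin n} {z : Cn n}

/-- The expression `z ↦ (z¹ / zⁱ, …, (zⁱ)ⁿ, …, zⁿ / zⁱ)` of `cover` in the chart over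
`{ξⁱ ≠ 0}`. -/
def coverChart (i : Fin n) (z : Cn n) : Cn n :=
  WithLp.toLp 2 (fun k => if k = i then z i ^ n else z k / z i)

theorem coverChart_apply_self (i : Fin n) (z : Cn n) : coverChart i z i = z i ^ n := if_pos rfl

theorem coverChart_apply_of_ne {k : Fin n} (hk : k ≠ i) (z : Cn n) :
    coverChart i z k = z k / z i := if_neg hk

theorem chart_cover (i : Fin n) (z : punctured n) : chart i (cover n z) = coverChart i z := by
  ext k
  change (if k = i then 1 * (z : Cn n) i ^ n else ratio i k (Projectivization.mk ℂ _ _)) =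
    if k = i then (z : Cn n) i ^ n else (z : Cn n) k / (z : Cn n) i
  rw [one_mul, ratio_mk]

theorem cover_mem_chart_source_iff (i : Fin n) (z : punctured n) :
    cover n z ∈ (chart i).source ↔ (z : Cn n) i ≠ 0 :=
  rep_mk_ne_zero_iff i _ _

theorem chart_symm_coverChart {z : punctured n} (hz : (z : Cn n) i ≠ 0) :
    (chart i).symm (coverChart i z) = cover n z := by
  rw [← chart_cover, (chart i).left_inv ((cover_mem_chart_source_iff i z).2 hz)]

theorem exists_coverChart_eq {y : Cn n} (hy : y i ≠ 0) :
    ∃ z : punctured n, (z : Cn n) i ≠ 0 ∧ coverChart i z = y := by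
  obtain ⟨c, hc⟩ := IsAlgClosed.exists_pow_nat_eq (y i) i.pos
  have hc0 : c ≠ 0 := by
    rintro rfl
    exact hy (by rw [← hc, zero_pow i.pos.ne'])
  let z : Cn n := WithLp.toLp 2 fun k => if k = i then c else y k * c
  have hzi : z i = c := if_pos rfl
  have hz : z ≠ 0 := fun h => hc0 (by rw [← hzi, h]; rfl)
  refine ⟨⟨z, hz⟩, by rwa [hzi], ?_⟩
  ext k
  rcases eq_or_ne k i with rfl | hk
  · rw [coverChart_apply_self, hzi, hc]
  · rw [coverChart_apply_of_ne hk]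
    simp [z, hk, hc0]

theorem contDiffAt_coverChart (hz : z i ≠ 0) : ContDiffAt ℂ ω (coverChart i) z := by
  refine (contDiffAt_piLp 2).2 fun k => ?_
  rcases eq_or_ne k i with rfl | hk
  · simp only [coverChart_apply_self]
    fun_prop
  · simp only [coverChart_apply_of_ne hk]
    exact ContDiffAt.div (by fun_prop) (by fun_prop) hz

/-- The complex derivative of `coverChart`. -/
def coverDeriv (i : Fin n) (z : Cn n) : Cn n →L[ℂ] Cn n := fderiv ℂ (coverChart i) z

theorem hasStrictFDerivAt_coverChart (hz : z i ≠ 0) :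
    HasStrictFDerivAt (coverChart i) (coverDeriv i z) z :=
  (contDiffAt_coverChart hz).hasStrictFDerivAt (by simp)

theorem hasFDerivAt_coverChart (hz : z i ≠ 0) :
    HasFDerivAt (coverChart i) (coverDeriv i z) z :=
  (hasStrictFDerivAt_coverChart hz).hasFDerivAt

theorem hasFDerivAt_apply (k : Fin n) (z : Cn n) :
    HasFDerivAt (fun z : Cn n => z k) (EuclideanSpace.proj k : Cn n →L[ℂ] ℂ) z :=
  (EuclideanSpace.proj k : Cn n →L[ℂ] ℂ).hasFDerivAt

theorem coverDeriv_apply_self (hz : z i ≠ 0) (v : Cn n) :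
    coverDeriv i z v i = n * z i ^ (n - 1) * v i := by
  have hcomp : HasFDerivAt (fun z : Cn n => z i ^ n)
      ((EuclideanSpace.proj i : Cn n →L[ℂ] ℂ).comp (coverDeriv i z)) z := by
    simpa only [Function.comp_def, coverChart_apply_self] using
      (hasFDerivAt_apply i (coverChart i z)).comp z (hasFDerivAt_coverChart hz)
  simpa [mul_assoc] using DFunLike.congr_fun (hcomp.unique ((hasFDerivAt_apply i z).pow n)) v

theorem coverDeriv_apply_of_ne {k : Fin n} (hk : k ≠ i) (hz : z i ≠ 0) (v : Cn n) :
    coverDeriv i z v k = v k / z i - z k * v i / z i ^ 2 := by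
  have hcomp : HasFDerivAt (fun z : Cn n => z k * (z i)⁻¹)
      ((EuclideanSpace.proj k : Cn n →L[ℂ] ℂ).comp (coverDeriv i z)) z := by
    simpa only [Function.comp_def, coverChart_apply_of_ne hk, div_eq_mul_inv] using
      (hasFDerivAt_apply k (coverChart i z)).comp z (hasFDerivAt_coverChart hz)
  have hquot := (hasFDerivAt_apply k z).mul
    ((hasDerivAt_inv hz).comp_hasFDerivAt z (hasFDerivAt_apply i z))
  have heq : coverDeriv i z v k = z k * (-(z i ^ 2)⁻¹ * v i) + (z i)⁻¹ * v k :=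
    DFunLike.congr_fun (hcomp.unique hquot) v
  rw [heq]
  ring

theorem coverDeriv_injective (hz : z i ≠ 0) : Function.Injective (coverDeriv i z) := by
  refine (injective_iff_map_eq_zero _).2 fun v hv => ?_
  have hvi : v i = 0 := by
    have h := coverDeriv_apply_self hz v
    simpa [hv, i.pos.ne', hz] using h
  ext k
  rcases eq_or_ne k i with rfl | hk
  · exact hvi
  · have h := (coverDeriv_apply_of_ne hk hz v).symm
    simpa [hv, hvi, hz] using h

theorem coverDeriv_surjective (hz : z i ≠ 0) : Function.Surjective (coverDeriv i z) :=
  LinearMap.surjective_of_injective (f := (coverDeriv i z : Cn n →ₗ[ℂ] Cn n))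
    (coverDeriv_injective hz)

/-- The transposed Jacobian matrix of `coverChart i`, as a unipotent times a diagonal matrix. -/
def coverMatrix (i : Fin n) (z : Cn n) : Matrix (Fin n) (Fin n) ℂ :=
  (1 + Matrix.vecMulVec (Pi.single i 1) (fun k => if k = i then 0 else -z k / z i)) *
    Matrix.diagonal (fun k => if k = i then n * z i ^ (n - 1) else (z i)⁻¹)

theorem det_coverMatrix (hz : z i ≠ 0) : (coverMatrix i z).det = n := by
  have hunipotent : (1 + Matrix.vecMulVec (Pi.single i 1)
      (fun k => if k = i then 0 else -z k / z i)).det = 1 := by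
    rw [Matrix.vecMulVec_eq Unit, Matrix.det_one_add_replicateCol_mul_replicateRow]
    simp
  have hprod : ∏ k ∈ Finset.univ.erase i, (if k = i then n * z i ^ (n - 1) else (z i)⁻¹) =
      (z i)⁻¹ ^ (n - 1) := by
    rw [Finset.prod_congr rfl fun k hk => if_neg (Finset.ne_of_mem_erase hk), Finset.prod_const,
      Finset.card_erase_of_mem (Finset.mem_univ i), Finset.card_univ, Fintype.card_fin]
  rw [coverMatrix, Matrix.det_mul, hunipotent, Matrix.det_diagonal,
    ← Finset.mul_prod_erase _ _ (Finset.mem_univ i), hprod, if_pos rfl, one_mul, mul_assoc,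
    ← mul_pow, mul_inv_cancel₀ hz, one_pow, mul_one]

theorem coverDeriv_eq_vecMul (hz : z i ≠ 0) (v : Cn n) :
    WithLp.ofLp (coverDeriv i z v) = Matrix.vecMul v (coverMatrix i z) := by
  ext k
  rw [coverMatrix, ← Matrix.vecMul_vecMul, Matrix.vecMul_diagonal, Matrix.vecMul_add,
    Matrix.vecMul_one, Matrix.vecMul_vecMulVec, dotProduct_single_one]
  rcases eq_or_ne k i with rfl | hk
  · simp [coverDeriv_apply_self hz, mul_comm]
  · simp only [coverDeriv_apply_of_ne hk hz, Pi.add_apply, Pi.smul_apply, hk, if_false,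
      smul_eq_mul]
    ring

theorem dzForm_coverDeriv (hz : z i ≠ 0) (v : Fin n → Cn n) :
    dzForm n (fun j => coverDeriv i z (v j)) = n * dzForm n v := by
  rw [dzForm_vecMul (coverMatrix i z) fun j => coverDeriv_eq_vecMul hz (v j), det_coverMatrix hz,
    mul_comm]

end CoverChart

section Transition

variable {n : ℕ} {i j : Fin n} {y : Cn n}

theorem eventually_apply_ne_zero (hy : y i ≠ 0) : ∀ᶠ w : Cn n in 𝓝 y, w i ≠ 0 :=
  (EuclideanSpace.proj i : Cn n →L[ℂ] ℂ).continuous.continuousAt.eventually_ne hy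

theorem dense_apply_ne_zero (i : Fin n) : Dense {y : Cn n | y i ≠ 0} := by
  refine (dense_compl_singleton (0 : ℂ)).preimage
    (f := (EuclideanSpace.proj i : Cn n →L[ℂ] ℂ)) (ContinuousLinearMap.isOpenMap _ fun c => ?_)
  exact ⟨EuclideanSpace.single i c, by simp⟩

theorem eq_of_eventually_eq_of_apply_ne_zero {X : Type*} [TopologicalSpace X] [T2Space X]
    {f g : Cn n → X} (hf : ContinuousAt f y) (hg : ContinuousAt g y)
    (h : ∀ᶠ w in 𝓝 y, w i ≠ 0 → f w = g w) : f y = g y :=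
  tendsto_nhds_unique_of_frequently_eq hf hg
    ((mem_closure_iff_frequently.1 (dense_apply_ne_zero i y)).mp h)

/-- The change of coordinates from the `i`-th to the `j`-th standard chart. -/
def transition (i j : Fin n) (y : Cn n) : Cn n := chart j ((chart i).symm y)

theorem eventually_chart_symm_mem_source (hy : (chart i).symm y ∈ (chart j).source) :
    ∀ᶠ w in 𝓝 y, (chart i).symm w ∈ (chart j).source :=
  ((chart i).continuousAt_symm trivial).eventually_mem ((chart j).open_source.mem_nhds hy)

theorem contDiffAt_transition (hy : (chart i).symm y ∈ (chart j).source) :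
    ContDiffAt ℂ ω (transition i j) y :=
  (contDiffOn_transition i j).contDiffAt
    (((chart i).symm ≫ₕ chart j).open_source.mem_nhds ⟨trivial, hy⟩)

theorem hasFDerivAt_transition (hy : (chart i).symm y ∈ (chart j).source) :
    HasFDerivAt (transition i j) (fderiv ℂ (transition i j) y) y :=
  ((contDiffAt_transition hy).differentiableAt (by simp)).hasFDerivAt

theorem transition_coverChart (j : Fin n) {z : punctured n} (hz : (z : Cn n) i ≠ 0) :
    transition i j (coverChart i z) = coverChart j z := by
  rw [transition, chart_symm_coverChart hz, chart_cover]

theorem chart_symm_coverChart_mem_source {z : punctured n} (hi : (z : Cn n) i ≠ 0) :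
    (chart i).symm (coverChart i z) ∈ (chart j).source ↔ (z : Cn n) j ≠ 0 := by
  rw [chart_symm_coverChart hi, cover_mem_chart_source_iff]

theorem fderiv_transition_coverDeriv {z : punctured n} (hi : (z : Cn n) i ≠ 0)
    (hj : (z : Cn n) j ≠ 0) (v : Cn n) :
    fderiv ℂ (transition i j) (coverChart i z) (coverDeriv i z v) = coverDeriv j z v := by
  have hcomp := (hasFDerivAt_transition ((chart_symm_coverChart_mem_source hi).2 hj)).comp
    (z : Cn n) (hasFDerivAt_coverChart hi)
  have heq : transition i j ∘ coverChart i =ᶠ[𝓝 (z : Cn n)] coverChart j := by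
    filter_upwards [(punctured n).isOpen.mem_nhds z.2, eventually_apply_ne_zero hi] with w hw hwi
    exact transition_coverChart j (z := ⟨w, hw⟩) hwi
  exact DFunLike.congr_fun
    (hcomp.unique ((hasFDerivAt_coverChart hj).congr_of_eventuallyEq heq)) v

theorem dzForm_fderiv_transition (hy : (chart i).symm y ∈ (chart j).source) (v : Fin n → Cn n) :
    dzForm n (fun k => fderiv ℂ (transition i j) y (v k)) = dzForm n v := by
  have hcont : ContinuousAt (fderiv ℂ (transition i j)) y :=
    (contDiffAt_transition hy).continuousAt_fderiv (by simp)
  refine eq_of_eventually_eq_of_apply_ne_zero (i := i) (g := fun _ => dzForm n v)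
    ((dzForm n).cont.continuousAt.comp
      (continuousAt_pi.2 fun k => hcont.clm_apply continuousAt_const)) continuousAt_const ?_
  filter_upwards [eventually_chart_symm_mem_source hy] with w hw hwi
  obtain ⟨z, hz, rfl⟩ := exists_coverChart_eq hwi
  rw [chart_symm_coverChart_mem_source hz] at hw
  choose u hu using fun k => coverDeriv_surjective hz (v k)
  obtain rfl : (fun k => coverDeriv i z (u k)) = v := funext hu
  change dzForm n (fun k => fderiv ℂ (transition i j) (coverChart i z) (coverDeriv i z (u k))) = _
  simp only [fderiv_transition_coverDeriv hz hw]
  rw [dzForm_coverDeriv hz, dzForm_coverDeriv hw]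

end Transition

/-! ### The holomorphic volume form -/

section VolumeForm

variable {n : ℕ}

/-- The index of the preferred chart at `p`. -/
def chartIndex (p : OMinus n) : Fin n := (exists_rep_ne_zero p).choose

theorem mem_chart_chartIndex_source (p : OMinus n) : p ∈ (chart (chartIndex p)).source :=
  (exists_rep_ne_zero p).choose_spec

theorem apply_chartIndex_cover_ne_zero (z : punctured n) :
    (z : Cn n) (chartIndex (cover n z)) ≠ 0 :=
  (cover_mem_chart_source_iff _ z).1 (mem_chart_chartIndex_source _)

theorem continuous_cover (n : ℕ) : Continuous (cover n) := by
  refine Continuous.subtype_mk (Continuous.prodMk ?_ (mk_isQuotientMap n).continuous) _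
  exact (PiLp.continuous_toLp 2 _).comp (continuous_pi fun k => by fun_prop)

theorem hasMFDerivAt_cover (z : punctured n) :
    HasMFDerivAt 𝓘(ℂ, Cn n) 𝓘(ℂ, Cn n) (cover n) z (coverDeriv (chartIndex (cover n z)) z) :=
  hasMFDerivAt_of_chartAt_eventuallyEq (continuous_cover n).continuousAt
    (.of_forall fun w => chart_cover _ w)
    (hasFDerivAt_coverChart (apply_chartIndex_cover_ne_zero z))

/-- The holomorphic volume form `η` of `𝒪(-n)`, which is `n⁻¹ dy¹ ∧ … ∧ dyⁿ` in each standard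
chart. -/
def volumeForm (n : ℕ) : TopForm n (OMinus n) := fun _ => (n : ℂ)⁻¹ • dzForm n

theorem volumeForm_ne_zero [NeZero n] (p : OMinus n) : volumeForm n p ≠ 0 :=
  smul_ne_zero (M := Cn n [⋀^Fin n]→L[ℂ] ℂ) (inv_ne_zero (NeZero.ne (n : ℂ))) (dzForm_ne_zero n)

theorem hasMFDerivAt_chart_symm (i : Fin n) (y : Cn n) :
    HasMFDerivAt 𝓘(ℂ, Cn n) 𝓘(ℂ, Cn n) (chart i).symm y
      (fderiv ℂ (transition i (chartIndex ((chart i).symm y))) y) :=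
  hasMFDerivAt_of_chartAt_eventuallyEq ((chart i).continuousAt_symm trivial)
    (.of_forall fun _ => rfl) (hasFDerivAt_transition (mem_chart_chartIndex_source _))

theorem volumeForm_pullback_chart_symm (i : Fin n) (y : Cn n) :
    TopForm.pullback (M := Cn n) (chart i).symm (volumeForm n) y = (n : ℂ)⁻¹ • dzForm n := by
  ext v
  exact ((volumeForm n).pullback_apply_of_hasMFDerivAt (hasMFDerivAt_chart_symm i y) v).trans
    (congrArg ((n : ℂ)⁻¹ * ·) (dzForm_fderiv_transition (mem_chart_chartIndex_source _) v))

theorem volumeForm_isHolomorphic (n : ℕ) : (volumeForm n).IsHolomorphic := by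
  rintro _ ⟨i, rfl⟩
  exact (differentiableOn_const ((n : ℂ)⁻¹ • dzForm n)).congr fun y _ =>
    volumeForm_pullback_chart_symm i y

theorem volumeForm_pullback_cover (n : ℕ) [NeZero n] :
    (volumeForm n).pullback (cover n) =
      (stdForm n).pullback (Subtype.val : punctured n → Cn n) := by
  ext z v
  calc (volumeForm n).pullback (cover n) z v
      = (n : ℂ)⁻¹ * dzForm n (fun k => coverDeriv (chartIndex (cover n z)) z (v k)) :=
        (volumeForm n).pullback_apply_of_hasMFDerivAt (hasMFDerivAt_cover z) v
    _ = (n : ℂ)⁻¹ * (n * dzForm n v) :=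
        congrArg _ (dzForm_coverDeriv (apply_chartIndex_cover_ne_zero z) v)
    _ = dzForm n v := inv_mul_cancel_left₀ (NeZero.ne (n : ℂ)) _
    _ = (stdForm n).pullback (Subtype.val : punctured n → Cn n) z v :=
        ((stdForm n).pullback_apply_of_hasMFDerivAt (hasMFDerivAt_subtype_val z) v).symm

end VolumeForm

section QuotientForm

variable {n : ℕ} [NeZero n]

/-- The holomorphic form `η^ℂ` on `(ℂⁿ ∖ 0) / μₙ` induced by `dz¹ ∧ … ∧ dzⁿ`. It has the same
expression in each chart, as these differ by roots of unity. -/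
def quotientForm (n : ℕ) [NeZero n] : TopForm n (PuncturedQuotient n) := fun _ => dzForm n

theorem exists_chart_quotientMap_eventuallyEq_smul
    {e : OpenPartialHomeomorph (PuncturedQuotient n) (Cn n)}
    (he : e ∈ atlas (Cn n) (PuncturedQuotient n)) {z : punctured n}
    (hz : quotientMap n z ∈ e.source) :
    ∃ ζ : ℂ, ζ ^ n = 1 ∧ ∀ᶠ w : punctured n in 𝓝 z, e (quotientMap n w) = ζ • (w : Cn n) := by
  obtain ⟨w, hw, hwz⟩ := (chart_puncturedQuotient he).1 _ (e.map_source hz)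
  rw [e.left_inv hz, eq_comm, quotientMap_eq_iff] at hwz
  obtain ⟨ζ, rfl⟩ := hwz
  refine ⟨((ζ : ℂˣ) : ℂ), ?_, ?_⟩
  · exact congrArg Units.val ((mem_rootsOfUnity n (ζ : ℂˣ)).1 ζ.2)
  have hcont : ContinuousAt (fun x : punctured n => ((ζ • x : punctured n) : Cn n)) z :=
    (continuous_subtype_val.comp (continuous_const_smul ζ)).continuousAt
  have htarget : ((ζ • z : punctured n) : Cn n) ∈ e.target := hw ▸ e.map_source hz
  filter_upwards [hcont.eventually_mem (e.open_target.mem_nhds htarget)] with x hx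
  rw [← (quotientMap_eq_iff.2 ⟨ζ, rfl⟩ : quotientMap n (ζ • x) = quotientMap n x)]
  exact (chart_puncturedQuotient he).2 (ζ • x) hx

theorem exists_hasMFDerivAt_quotientMap (z : punctured n) :
    ∃ ζ : ℂ, ζ ^ n = 1 ∧ HasMFDerivAt 𝓘(ℂ, Cn n) 𝓘(ℂ, Cn n) (quotientMap n) z
      (ζ • ContinuousLinearMap.id ℂ (Cn n)) := by
  obtain ⟨ζ, hζ, hev⟩ := exists_chart_quotientMap_eventuallyEq_smul
    (chart_mem_atlas (Cn n) (quotientMap n z)) (mem_chart_source _ _)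
  exact ⟨ζ, hζ, hasMFDerivAt_of_chartAt_eventuallyEq
    (quotientMap_isLocalHomeomorph n).continuous.continuousAt hev
    ((hasFDerivAt_id (z : Cn n)).const_smul ζ)⟩

theorem quotientForm_pullback (n : ℕ) [NeZero n] :
    (quotientForm n).pullback (quotientMap n) =
      (stdForm n).pullback (Subtype.val : punctured n → Cn n) := by
  ext z v
  obtain ⟨ζ, hζ, hderiv⟩ := exists_hasMFDerivAt_quotientMap z
  calc (quotientForm n).pullback (quotientMap n) z v
      = dzForm n (fun k => ζ • (v k : Cn n)) :=
        (quotientForm n).pullback_apply_of_hasMFDerivAt hderiv v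
    _ = ζ ^ n * dzForm n v := dzForm_smul ζ v
    _ = dzForm n v := by rw [hζ, one_mul]
    _ = (stdForm n).pullback (Subtype.val : punctured n → Cn n) z v :=
        ((stdForm n).pullback_apply_of_hasMFDerivAt (hasMFDerivAt_subtype_val z) v).symm

theorem quotientForm_pullback_chart_symm {e : OpenPartialHomeomorph (PuncturedQuotient n) (Cn n)}
    (he : e ∈ atlas (Cn n) (PuncturedQuotient n)) {y : Cn n} (hy : y ∈ e.target) :
    TopForm.pullback (M := Cn n) e.symm (quotientForm n) y = dzForm n := by
  obtain ⟨z, rfl, -⟩ := (chart_puncturedQuotient he).1 y hy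
  have hev : e.symm ∘ Subtype.val =ᶠ[𝓝 z] quotientMap n := by
    filter_upwards [continuous_subtype_val.continuousAt.eventually_mem
      (e.open_target.mem_nhds hy)] with w hw
    obtain ⟨w', hw', h⟩ := (chart_puncturedQuotient he).1 w hw
    rwa [Subtype.ext hw'] at h
  refine TopForm.eq_of_pullback_eq (β := stdForm n) (hasMFDerivAt_subtype_val z)
    Function.surjective_id ?_
  rw [← TopForm.pullback_comp_apply _ (mdifferentiableAt_atlas_symm he hy)
    (hasMFDerivAt_subtype_val z).mdifferentiableAt, TopForm.pullback_congr _ hev,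
    quotientForm_pullback]

theorem quotientForm_isHolomorphic (n : ℕ) [NeZero n] : (quotientForm n).IsHolomorphic := by
  intro e he
  exact (differentiableOn_const (dzForm n)).congr fun y hy => quotientForm_pullback_chart_symm he hy

end QuotientForm

section BlowDown

variable {n : ℕ} [NeZero n]

/-- The covering `ℂⁿ ∖ 0 → 𝒪(-n) ∖ ℂℙⁿ⁻¹`, through which the blow-down map is compared with the
quotient map. -/
def coverOffZeroSection (n : ℕ) [NeZero n] (z : punctured n) : offZeroSection n :=
  ⟨cover n z, cover_mem z⟩

theorem coverOffZeroSection_surjective (n : ℕ) [NeZero n] :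
    Function.Surjective (coverOffZeroSection n) := by
  intro p
  obtain ⟨w, hpow, hline⟩ := exists_isRoot p
  refine ⟨w, Subtype.ext (Subtype.ext (Prod.ext ?_ hline))⟩
  ext k
  exact (one_mul _).trans (hpow k)

theorem blowDown_comp_coverOffZeroSection (n : ℕ) [NeZero n] :
    blowDown n ∘ coverOffZeroSection n = quotientMap n := funext blowDown_cover

theorem hasMFDerivAt_coverOffZeroSection (z : punctured n) :
    HasMFDerivAt 𝓘(ℂ, Cn n) 𝓘(ℂ, Cn n) (coverOffZeroSection n) z
      (coverDeriv (chartIndex (cover n z)) z) :=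
  hasMFDerivAt_codRestrict (hasMFDerivAt_cover z) cover_mem

theorem mdifferentiable_blowDown (n : ℕ) [NeZero n] :
    MDifferentiable 𝓘(ℂ, Cn n) 𝓘(ℂ, Cn n) (blowDown n) := by
  intro p
  obtain ⟨z, rfl⟩ := coverOffZeroSection_surjective n p
  have hz := apply_chartIndex_cover_ne_zero z
  let coverEquiv : Cn n ≃L[ℂ] Cn n := .ofBijective (coverDeriv (chartIndex (cover n z)) z)
    (LinearMap.ker_eq_bot.2 (coverDeriv_injective hz))
    (LinearMap.range_eq_top.2 (coverDeriv_surjective hz))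
  have hstrict : HasStrictFDerivAt (coverChart (chartIndex (cover n z)))
      (coverEquiv : Cn n →L[ℂ] Cn n) (z : Cn n) := hasStrictFDerivAt_coverChart hz
  refine mdifferentiableAt_of_comp (hasMFDerivAt_coverOffZeroSection z).continuousAt
    (.of_forall fun w => chart_cover _ w) hstrict ?_
  rw [blowDown_comp_coverOffZeroSection]
  exact (exists_hasMFDerivAt_quotientMap z).choose_spec.2.mdifferentiableAt

theorem volumeForm_pullback (n : ℕ) [NeZero n] :
    (volumeForm n).pullback (Subtype.val : offZeroSection n → OMinus n) =
      (quotientForm n).pullback (blowDown n) := by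
  ext1 p
  obtain ⟨z, rfl⟩ := coverOffZeroSection_surjective n p
  have hcover := (hasMFDerivAt_coverOffZeroSection z).mdifferentiableAt
  refine TopForm.eq_of_pullback_eq (hasMFDerivAt_coverOffZeroSection z)
    (coverDeriv_surjective (apply_chartIndex_cover_ne_zero z)) ?_
  rw [← TopForm.pullback_comp_apply _ (mdifferentiable_blowDown n _) hcover,
    ← TopForm.pullback_comp_apply _ (hasMFDerivAt_subtype_val _).mdifferentiableAt hcover,
    blowDown_comp_coverOffZeroSection, quotientForm_pullback]
  exact congrFun (volumeForm_pullback_cover n) z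

end BlowDown

/-! ### The metric on `ℂⁿ ∖ 0` -/

section Trace

variable {n : ℕ}

theorem sum_det_updateRow_mul {m R : Type*} [Fintype m] [DecidableEq m] [CommRing R]
    (B C : Matrix m m R) : ∑ j, (B.updateRow j ((B * C) j)).det = C.trace * B.det := by
  calc ∑ j, (B.updateRow j ((B * C) j)).det = (B * C * B.adjugate).trace := by
        refine Finset.sum_congr rfl fun j _ => ?_
        rw [← Matrix.cramer_transpose_apply, Matrix.cramer_eq_adjugate_mulVec,
          ← Matrix.adjugate_transpose, Matrix.mulVec_transpose]
        rfl
    _ = C.trace * B.det := by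
        rw [Matrix.trace_mul_comm, ← mul_assoc, Matrix.adjugate_mul, smul_mul_assoc, one_mul,
          Matrix.trace_smul, smul_eq_mul, mul_comm]

theorem sum_dzForm_update (A : Cn n →ₗ[ℂ] Cn n) (W : Fin n → Cn n) :
    ∑ j, dzForm n (Function.update W j (A (W j))) = LinearMap.trace ℂ (Cn n) A * dzForm n W := by
  set b := (EuclideanSpace.basisFun (Fin n) ℂ).toBasis
  rw [LinearMap.trace_eq_matrix_trace ℂ b, ← Matrix.trace_transpose, dzForm_apply,
    ← sum_det_updateRow_mul]
  refine Finset.sum_congr rfl fun j _ => ?_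
  have hA : ∀ k, A (W j) k =
      (Matrix.of (fun j k => W j k) * (LinearMap.toMatrix b b A).transpose) j k := fun k => by
    simpa [b, Matrix.mul_apply, Matrix.mulVec, dotProduct, mul_comm] using
      (congrFun (LinearMap.toMatrix_mulVec_repr b b A (W j)) k).symm
  rw [dzForm_apply]
  congr 1
  ext l k
  by_cases hl : l = j
  · subst hl
    simpa using hA k
  · simp [hl]

end Trace

section Radial

variable {n : ℕ} {a t : ℝ} {z : Cn n}

/-- The conformal factor `(1 + aⁿ/tⁿ)^{1/n}` of the Calabi-Eguchi-Hanson metric, `t = |z|²`. -/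
def scale (n : ℕ) (a t : ℝ) : ℝ := (1 + a ^ n / t ^ n) ^ (1 / n : ℝ)

/-- The factor `aⁿ/(aⁿ + tⁿ)` by which the Calabi-Eguchi-Hanson metric, `t = |z|²`, is shrunk in the
direction of `z`, relative to the conformal factor `scale n a t`. -/
def defect (n : ℕ) (a t : ℝ) : ℝ := a ^ n / (a ^ n + t ^ n)

theorem inner_eq_sum (z v : Cn n) : inner ℂ z v = ∑ k, (starRingEnd ℂ) (z k) * v k := by
  simp [PiLp.inner_apply, mul_comm]

theorem metricOnPunctured_eq (a : ℝ) (z v w : Cn n) :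
    metricOnPunctured a z v w = scale n a (‖z‖ ^ 2) * (inner ℂ w v).re -
      scale n a (‖z‖ ^ 2) * defect n a (‖z‖ ^ 2) / ‖z‖ ^ 2 * (inner ℂ z v * inner ℂ w z).re := by
  have hsum : ∑ μ, ∑ ν, metricMatrix a z μ ν * v μ * (starRingEnd ℂ) (w ν) =
      ((scale n a (‖z‖ ^ 2) : ℝ) : ℂ) * inner ℂ w v -
      ((scale n a (‖z‖ ^ 2) * defect n a (‖z‖ ^ 2) / ‖z‖ ^ 2 : ℝ) : ℂ) *
        (inner ℂ z v * inner ℂ w z) := by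
    have hdiag : inner ℂ w v = ∑ μ, ∑ ν, if μ = ν then (starRingEnd ℂ) (w ν) * v μ else 0 := by
      simp [inner_eq_sum]
    rw [hdiag, inner_eq_sum z v, inner_eq_sum w z, Finset.sum_mul_sum]
    simp only [Finset.mul_sum, ← Finset.sum_sub_distrib]
    refine Finset.sum_congr rfl fun μ _ => Finset.sum_congr rfl fun ν _ => ?_
    simp only [metricMatrix, scale, defect]
    push_cast
    split_ifs <;> ring
  rw [metricOnPunctured, hsum, Complex.sub_re, Complex.re_ofReal_mul, Complex.re_ofReal_mul]

/-- The Christoffel symbols of `metricOnPunctured`. They are complex bilinear because the metric is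
Kähler. -/
def radialChristoffel (a : ℝ) (z u : Cn n) : Cn n →ₗ[ℂ] Cn n :=
  (-(defect n a (‖z‖ ^ 2) / ‖z‖ ^ 2 : ℝ) : ℂ) •
      (inner ℂ z u • LinearMap.id + (innerₛₗ ℂ z).smulRight u) +
    (((n + 1) * defect n a (‖z‖ ^ 2) / (‖z‖ ^ 2) ^ 2 : ℝ) * inner ℂ z u : ℂ) •
      (innerₛₗ ℂ z).smulRight z

theorem radialChristoffel_apply (a : ℝ) (z u v : Cn n) :
    radialChristoffel a z u v =
      (-(defect n a (‖z‖ ^ 2) / ‖z‖ ^ 2 : ℝ) : ℂ) • (inner ℂ z u • v + inner ℂ z v • u) +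
        (((n + 1) * defect n a (‖z‖ ^ 2) / (‖z‖ ^ 2) ^ 2 : ℝ) * inner ℂ z u : ℂ) •
          inner ℂ z v • z := rfl

theorem radialChristoffel_comm (a : ℝ) (z u v : Cn n) :
    radialChristoffel a z u v = radialChristoffel a z v u := by
  rw [radialChristoffel_apply, radialChristoffel_apply, add_comm (inner ℂ z u • v), smul_smul,
    smul_smul, mul_right_comm]

theorem trace_radialChristoffel (a : ℝ) (hz : z ≠ 0) (u : Cn n) :
    LinearMap.trace ℂ (Cn n) (radialChristoffel a z u) = 0 := by
  have hz' : (‖z‖ : ℂ) ≠ 0 := by exact_mod_cast norm_ne_zero_iff.2 hz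
  have htrace : ∀ v w : Cn n,
      LinearMap.trace ℂ (Cn n) ((innerₛₗ ℂ v).smulRight w) = inner ℂ v w := fun v w =>
    LinearMap.trace_smulRight _ _
  have hzz : inner ℂ z z = (‖z‖ : ℂ) ^ 2 := inner_self_eq_norm_sq_to_K z
  simp only [radialChristoffel, map_add, map_smul, htrace, LinearMap.trace_id, hzz, smul_eq_mul,
    finrank_euclideanSpace, Fintype.card_fin]
  push_cast
  field_simp
  ring

theorem hasFDerivAt_norm_sq (z : Cn n) :
    HasFDerivAt (fun z : Cn n => ‖z‖ ^ 2)
      ((2 : ℝ) • Complex.reCLM.comp ((innerSL ℂ z).restrictScalars ℝ)) z := by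
  have h := Complex.reCLM.hasFDerivAt.comp z
    ((hasFDerivAt_id (𝕜 := ℝ) z).inner ℂ (hasFDerivAt_id z))
  refine (h.congr_of_eventuallyEq (.of_forall fun x => ?_)).congr_fderiv ?_
  · exact (inner_self_eq_norm_sq (𝕜 := ℂ) x).symm
  · ext u
    have hsymm : (inner ℂ u z).re = (inner ℂ z u).re := by
      rw [← inner_conj_symm, Complex.conj_re]
    simp only [id_eq, ContinuousLinearMap.comp_apply, ContinuousLinearMap.prod_apply,
      ContinuousLinearMap.id_apply, fderivInnerCLM_apply, Complex.reCLM_apply, Complex.add_re,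
      hsymm, smul_apply, ContinuousLinearMap.coe_restrictScalars', coe_innerSL_apply, smul_eq_mul]
    ring

variable [NeZero n]

theorem hasDerivAt_scale (ha : 0 < a) (ht : 0 < t) :
    HasDerivAt (scale n a) (-(scale n a t * defect n a t / t)) t := by
  obtain ⟨m, hm⟩ := Nat.exists_eq_succ_of_ne_zero (NeZero.ne n)
  have hn : (n : ℝ) ≠ 0 := by exact_mod_cast NeZero.ne n
  have hbase : HasDerivAt (fun t : ℝ => 1 + a ^ n / t ^ n)
      (-(n * (1 / t) * (a ^ n / t ^ n))) t := by
    refine (((hasDerivAt_const t (a ^ n)).div (hasDerivAt_pow n t)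
      (by positivity)).const_add 1).congr_deriv ?_
    simp only [hm, Nat.succ_eq_add_one, Nat.add_sub_cancel]
    field_simp
    ring
  have hpos : 0 < 1 + a ^ n / t ^ n := by positivity
  refine (hbase.rpow_const (p := 1 / n) (.inl hpos.ne')).congr_deriv ?_
  rw [Real.rpow_sub_one hpos.ne']
  simp only [scale, defect]
  field_simp
  ring

theorem hasDerivAt_defect (ha : 0 < a) (ht : 0 < t) :
    HasDerivAt (defect n a) (-(n * defect n a t * (1 - defect n a t) / t)) t := by
  obtain ⟨m, hm⟩ := Nat.exists_eq_succ_of_ne_zero (NeZero.ne n)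
  refine ((hasDerivAt_const t (a ^ n)).div ((hasDerivAt_pow n t).const_add (a ^ n))
    (by positivity)).congr_deriv ?_
  simp only [hm, Nat.succ_eq_add_one, Nat.add_sub_cancel, defect]
  field_simp
  ring

theorem hasDerivAt_scale_mul_defect (ha : 0 < a) (ht : 0 < t) :
    HasDerivAt (fun t => scale n a t * defect n a t / t)
      (-(scale n a t * defect n a t / t * ((n + 1) - (n - 1) * defect n a t) / t)) t := by
  refine (((hasDerivAt_scale ha ht).mul (hasDerivAt_defect ha ht)).div (hasDerivAt_id t)
    ht.ne').congr_deriv ?_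
  simp only [id, Pi.mul_apply]
  field_simp
  ring

theorem differentiableAt_metricOnPunctured (ha : 0 < a) (hz : z ≠ 0) (v w : Cn n) :
    DifferentiableAt ℝ (fun z => metricOnPunctured a z v w) z := by
  have ht : 0 < ‖z‖ ^ 2 := by positivity
  have hscale := ((hasDerivAt_scale (n := n) ha ht).comp_hasFDerivAt z
    (hasFDerivAt_norm_sq z)).differentiableAt
  have hdefect := ((hasDerivAt_scale_mul_defect (n := n) ha ht).comp_hasFDerivAt z
    (hasFDerivAt_norm_sq z)).differentiableAt
  have hinner : DifferentiableAt ℝ (fun z : Cn n => (inner ℂ z v * inner ℂ w z).re) z :=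
    Complex.reCLM.differentiableAt.comp z
      ((differentiableAt_id.inner ℂ (differentiableAt_const v)).mul
        ((differentiableAt_const w).inner ℂ differentiableAt_id))
  exact ((hscale.mul_const (inner ℂ w v).re).sub (hdefect.mul hinner)).congr_of_eventuallyEq
    (.of_forall fun x => metricOnPunctured_eq a x v w)

theorem fderiv_metricOnPunctured_apply (ha : 0 < a) (hz : z ≠ 0) (u v w : Cn n) :
    fderiv ℝ (fun z => metricOnPunctured a z v w) z u =
      metricOnPunctured a z (radialChristoffel a z u v) w +
        metricOnPunctured a z v (radialChristoffel a z u w) := by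
  have ht : 0 < ‖z‖ ^ 2 := by positivity
  have hscale := (hasDerivAt_scale (n := n) ha ht).comp_hasFDerivAt z (hasFDerivAt_norm_sq z)
  have hdefect :=
    (hasDerivAt_scale_mul_defect (n := n) ha ht).comp_hasFDerivAt z (hasFDerivAt_norm_sq z)
  have hinner := Complex.reCLM.hasFDerivAt.comp z
    (((hasFDerivAt_id (𝕜 := ℝ) z).inner ℂ (hasFDerivAt_const v z)).mul
      ((hasFDerivAt_const (𝕜 := ℝ) w z).inner ℂ (hasFDerivAt_id z)))
  have hmetric := ((hscale.mul_const (inner ℂ w v).re).sub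
    (hdefect.mul hinner)).congr_of_eventuallyEq (f₁ := fun z => metricOnPunctured a z v w)
    (.of_forall fun x => metricOnPunctured_eq a x v w)
  have hconj : ∀ x y : Cn n, inner ℂ x y = (starRingEnd ℂ) (inner ℂ y x) :=
    fun x y => (inner_conj_symm x y).symm
  have hzz : inner ℂ z z = ((‖z‖ ^ 2 : ℝ) : ℂ) := by
    rw [inner_self_eq_norm_sq_to_K (𝕜 := ℂ) z]
    push_cast
    rfl
  rw [hmetric.fderiv, metricOnPunctured_eq, metricOnPunctured_eq]
  simp only [radialChristoffel_apply, inner_add_left, inner_add_right, inner_smul_left,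
    inner_smul_right, hzz, sub_apply, smul_apply, add_apply, ContinuousLinearMap.comp_apply,
    ContinuousLinearMap.prod_apply, fderivInnerCLM_apply, ContinuousLinearMap.coe_id', id,
    Complex.reCLM_apply, Function.comp_apply, Pi.mul_apply, zero_apply,
    inner_zero_left, inner_zero_right, ContinuousLinearMap.coe_restrictScalars',
    innerSL_apply_apply, smul_eq_mul]
  rw [hconj w z, hconj w u, hconj u z]
  generalize inner ℂ z u = zu, inner ℂ z v = zv, inner ℂ z w = zw, inner ℂ u v = uv,
    inner ℂ u w = uw, inner ℂ w v = wv, defect n a (‖z‖ ^ 2) = d, scale n a (‖z‖ ^ 2) = p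
  generalize ‖z‖ ^ 2 = t at ht
  simp only [map_neg, map_mul, Complex.conj_ofReal, Complex.mul_re, Complex.mul_im,
    Complex.add_re, Complex.add_im, Complex.neg_re, Complex.neg_im, Complex.conj_re,
    Complex.conj_im, Complex.ofReal_re, Complex.ofReal_im, Complex.zero_re, Complex.zero_im]
  field_simp
  ring

end Radial

/-! ### The metric in the standard charts -/

section ChartMetric

variable {n : ℕ}

/-- The projection that forgets the `i`-th coordinate, i.e. the derivative of `affineRep i`. -/
def dropCoord (i : Fin n) : Cn n →ₗ[ℂ] Cn n where
  toFun v := WithLp.toLp 2 fun k => if k = i then 0 else v k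
  map_add' v w := by ext k; by_cases hk : k = i <;> simp [hk]
  map_smul' c v := by ext k; by_cases hk : k = i <;> simp [hk]

theorem dropCoord_apply (i k : Fin n) (v : Cn n) :
    dropCoord i v k = if k = i then 0 else v k := rfl

/-- The coefficient of `ξ = affineRep i y` in the orthogonal projection to `ℂ ξ` of the velocity
`dropCoord i v` of the homogeneous coordinates `ξ`. -/
def lineCoeff (i : Fin n) (y : Cn n) : Cn n →ₗ[ℂ] ℂ :=
  ((‖affineRep i y‖ ^ 2 : ℝ) : ℂ)⁻¹ • (innerSL ℂ (affineRep i y)).toLinearMap ∘ₗ dropCoord i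

theorem lineCoeff_apply (i : Fin n) (y v : Cn n) :
    lineCoeff i y v =
      ((‖affineRep i y‖ ^ 2 : ℝ) : ℂ)⁻¹ * inner ℂ (affineRep i y) (dropCoord i v) := rfl

/-- The part of the velocity `dropCoord i v` of the homogeneous coordinates `ξ = affineRep i y` that
is orthogonal to `ξ`, i.e. the projection of `v` to the tangent space of `ℂℙⁿ⁻¹` at `[ξ]`. -/
def horizontalPart (i : Fin n) (y : Cn n) : Cn n →ₗ[ℂ] Cn n :=
  dropCoord i - (lineCoeff i y).smulRight (affineRep i y)

theorem horizontalPart_apply (i : Fin n) (y v : Cn n) :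
    horizontalPart i y v = dropCoord i v - lineCoeff i y v • affineRep i y := rfl

/-- The component of a tangent vector `v` along the fibres of `𝒪(-n)` in the `i`-th chart, relative
to the connection of the line bundle. The factor `1/n` makes it `(zⁱ)ⁿ ⟨z, v⟩ / |z|²` for the image
of a vector `v` under the covering `cover` at `z`. -/
def verticalPart (i : Fin n) (y : Cn n) : Cn n →ₗ[ℂ] ℂ :=
  (n : ℂ)⁻¹ • (EuclideanSpace.proj i : Cn n →L[ℂ] ℂ).toLinearMap + y i • lineCoeff i y

theorem verticalPart_apply (i : Fin n) (y v : Cn n) :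
    verticalPart i y v = (n : ℂ)⁻¹ * v i + y i * lineCoeff i y v := rfl

/-- The value of `aⁿ + uⁿ`, `u = |z|²`, in the `i`-th chart. It is smooth and positive across the
zero section `y i = 0`, and hence so are the weights below. -/
def radius (a : ℝ) (i : Fin n) (y : Cn n) : ℝ :=
  a ^ n + ‖y i‖ ^ 2 * (‖affineRep i y‖ ^ 2) ^ n

/-- The weight of `horizontalPart` in the metric. -/
def horizontalWeight (a : ℝ) (i : Fin n) (y : Cn n) : ℝ :=
  radius a i y ^ (1 / n : ℝ) / ‖affineRep i y‖ ^ 2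

/-- The weight of `verticalPart` in the metric. -/
def verticalWeight (a : ℝ) (i : Fin n) (y : Cn n) : ℝ :=
  radius a i y ^ (1 / n : ℝ) / radius a i y * (‖affineRep i y‖ ^ 2) ^ n

/-- The Calabi-Eguchi-Hanson metric in the `i`-th chart: an orthogonal sum of metrics on the
horizontal and the vertical parts. -/
def chartMetric (a : ℝ) (i : Fin n) (y : Cn n) : Cn n →L[ℝ] Cn n →L[ℝ] ℝ :=
  LinearMap.toContinuousLinearMap
    (LinearMap.toContinuousLinearMap.toLinearMap ∘ₗ
      LinearMap.mk₂ ℝ (fun v w => horizontalWeight a i y *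
          (inner ℂ (horizontalPart i y w) (horizontalPart i y v)).re +
        verticalWeight a i y *
          (verticalPart i y v * (starRingEnd ℂ) (verticalPart i y w)).re)
      (fun v v' w => by simp only [map_add, inner_add_right, Complex.add_re, add_mul]; ring)
      (fun c v w => by
        simp only [LinearMap.map_smul_of_tower, inner_smul_right_eq_smul, Complex.smul_re,
          smul_mul_assoc, smul_eq_mul]; ring)
      (fun v w w' => by simp only [map_add, inner_add_left, Complex.add_re, mul_add]; ring)
      (fun c v w => by
        have hh : horizontalPart i y (c • w) = (c : ℂ) • horizontalPart i y w := by
          rw [← map_smul]; rfl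
        have hv : verticalPart i y (c • w) = (c : ℂ) * verticalPart i y w := by
          rw [← smul_eq_mul, ← map_smul]; rfl
        rw [hh, hv, inner_smul_left, map_mul, Complex.conj_ofReal, mul_left_comm,
          Complex.re_ofReal_mul, Complex.re_ofReal_mul, smul_eq_mul]
        ring))

theorem chartMetric_apply (a : ℝ) (i : Fin n) (y v w : Cn n) :
    chartMetric a i y v w = horizontalWeight a i y *
          (inner ℂ (horizontalPart i y w) (horizontalPart i y v)).re +
        verticalWeight a i y *
          (verticalPart i y v * (starRingEnd ℂ) (verticalPart i y w)).re := rfl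

theorem chartMetric_symm (a : ℝ) (i : Fin n) (y v w : Cn n) :
    chartMetric a i y v w = chartMetric a i y w v := by
  rw [chartMetric_apply, chartMetric_apply, ← inner_conj_symm, Complex.conj_re]
  congr 2
  simp only [Complex.mul_re, Complex.conj_re, Complex.conj_im]
  ring

variable {a : ℝ}

theorem norm_affineRep_pos (i : Fin n) (y : Cn n) : 0 < ‖affineRep i y‖ :=
  norm_pos_iff.2 (affineRep_ne_zero i y)

theorem radius_pos (ha : 0 < a) (i : Fin n) (y : Cn n) : 0 < radius a i y := by
  unfold radius; positivity

theorem horizontalWeight_pos (ha : 0 < a) (i : Fin n) (y : Cn n) :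
    0 < horizontalWeight a i y := by
  have := radius_pos ha i y
  have := norm_affineRep_pos i y
  unfold horizontalWeight; positivity

theorem verticalWeight_pos (ha : 0 < a) (i : Fin n) (y : Cn n) :
    0 < verticalWeight a i y := by
  have := radius_pos ha i y
  have := norm_affineRep_pos i y
  unfold verticalWeight; positivity

theorem eq_zero_of_horizontalPart_of_verticalPart {i : Fin n} {y v : Cn n}
    (hh : horizontalPart i y v = 0) (hv : verticalPart i y v = 0) : v = 0 := by
  have hline : lineCoeff i y v = 0 := by
    simpa [horizontalPart_apply, dropCoord_apply, affineRep] using congrArg (fun w : Cn n => w i) hh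
  have hdrop : dropCoord i v = 0 := by
    simpa only [horizontalPart_apply, hline, zero_smul, sub_zero] using hh
  ext k
  by_cases hk : k = i
  · have hn : (n : ℂ) ≠ 0 := by exact_mod_cast i.pos.ne'
    simpa [verticalPart_apply, hline, hn, hk] using hv
  · simpa [dropCoord_apply, hk] using congrArg (fun w : Cn n => w k) hdrop

theorem chartMetric_self (a : ℝ) (i : Fin n) (y v : Cn n) :
    chartMetric a i y v v = horizontalWeight a i y * ‖horizontalPart i y v‖ ^ 2 +
      verticalWeight a i y * ‖verticalPart i y v‖ ^ 2 := by
  have hh : (inner ℂ (horizontalPart i y v) (horizontalPart i y v)).re =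
      ‖horizontalPart i y v‖ ^ 2 := inner_self_eq_norm_sq (𝕜 := ℂ) _
  rw [chartMetric_apply, hh, Complex.mul_conj, Complex.ofReal_re, Complex.normSq_eq_norm_sq]

theorem chartMetric_pos (ha : 0 < a) (i : Fin n) (y : Cn n) {v : Cn n} (hv : v ≠ 0) :
    0 < chartMetric a i y v v := by
  have hposh := horizontalWeight_pos ha i y
  have hposv := verticalWeight_pos ha i y
  rw [chartMetric_self]
  by_cases hh : horizontalPart i y v = 0
  · have : 0 < ‖verticalPart i y v‖ := norm_pos_iff.2 fun h =>
      hv (eq_zero_of_horizontalPart_of_verticalPart hh h)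
    positivity
  · have : 0 < ‖horizontalPart i y v‖ := norm_pos_iff.2 hh
    positivity

theorem contDiff_affineRep_real (i : Fin n) : ContDiff ℝ ∞ (affineRep i : Cn n → Cn n) := by
  rw [contDiff_piLp]
  exact fun k => ((contDiff_affineRep i k).restrict_scalars ℝ).of_le (by simp)

theorem contDiff_normSq_affineRep (i : Fin n) :
    ContDiff ℝ ∞ (fun y : Cn n => ‖affineRep i y‖ ^ 2) := by
  have h := Complex.reCLM.contDiff.comp
    ((contDiff_affineRep_real i).inner ℂ (contDiff_affineRep_real i))
  convert h using 1
  ext y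
  simpa using (inner_self_eq_norm_sq (𝕜 := ℂ) (affineRep i y)).symm

theorem contDiff_coord_real (i : Fin n) : ContDiff ℝ ∞ (fun y : Cn n => y i) :=
  ((EuclideanSpace.proj i : Cn n →L[ℂ] ℂ).contDiff.restrict_scalars ℝ)

theorem contDiff_radius (a : ℝ) (i : Fin n) : ContDiff ℝ ∞ (radius a i) :=
  contDiff_const.add (((contDiff_coord_real i).norm_sq ℝ).mul
    ((contDiff_normSq_affineRep i).pow n))

theorem contDiff_lineCoeff (i : Fin n) (v : Cn n) :
    ContDiff ℝ ∞ (fun y => lineCoeff i y v) := by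
  have hnorm : ContDiff ℝ ∞ (fun y : Cn n => ((‖affineRep i y‖ ^ 2 : ℝ) : ℂ)) :=
    Complex.ofRealCLM.contDiff.comp (contDiff_normSq_affineRep i)
  refine (hnorm.inv fun y => ?_).mul ((contDiff_affineRep_real i).inner ℂ contDiff_const)
  have := norm_affineRep_pos i y
  exact_mod_cast (by positivity : ‖affineRep i y‖ ^ 2 ≠ 0)

theorem contDiff_horizontalPart (i : Fin n) (v : Cn n) :
    ContDiff ℝ ∞ (fun y => horizontalPart i y v) :=
  contDiff_const.sub ((contDiff_lineCoeff i v).smul (contDiff_affineRep_real i))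

theorem contDiff_verticalPart (i : Fin n) (v : Cn n) :
    ContDiff ℝ ∞ (fun y => verticalPart i y v) :=
  contDiff_const.add ((contDiff_coord_real i).mul (contDiff_lineCoeff i v))

theorem contDiff_chartMetric (ha : 0 < a) (i : Fin n) : ContDiff ℝ ∞ (chartMetric a i) := by
  have hradius : ContDiff ℝ ∞ (fun y => radius a i y ^ (1 / n : ℝ)) :=
    (contDiff_radius a i).rpow_const_of_ne fun y => (radius_pos ha i y).ne'
  have hnorm : ∀ y : Cn n, ‖affineRep i y‖ ^ 2 ≠ 0 := fun y =>
    pow_ne_zero _ (norm_affineRep_pos i y).ne'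
  refine contDiff_clm_apply_iff.2 fun v => contDiff_clm_apply_iff.2 fun w => ?_
  simp only [chartMetric_apply]
  refine ((hradius.div (contDiff_normSq_affineRep i) hnorm).mul ?_).add
    (((hradius.div (contDiff_radius a i) fun y => (radius_pos ha i y).ne').mul
      ((contDiff_normSq_affineRep i).pow n)).mul ?_)
  · exact Complex.reCLM.contDiff.comp
      ((contDiff_horizontalPart i w).inner ℂ (contDiff_horizontalPart i v))
  · exact Complex.reCLM.contDiff.comp ((contDiff_verticalPart i v).mul
      (Complex.conjCLE.contDiff.comp (contDiff_verticalPart i w)))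

end ChartMetric

section Pullback

variable {n : ℕ} {a : ℝ} {i j : Fin n} {y z : Cn n}

theorem ne_zero_of_apply_ne_zero (hz : z i ≠ 0) : z ≠ 0 := by
  rintro rfl
  exact hz rfl

theorem affineRep_coverChart (hz : z i ≠ 0) : affineRep i (coverChart i z) = (z i)⁻¹ • z := by
  ext k
  by_cases hk : k = i
  · subst hk
    simp [affineRep, hz]
  · simp [affineRep, hk, coverChart_apply_of_ne, div_eq_inv_mul]

theorem norm_sq_affineRep_coverChart (hz : z i ≠ 0) :
    ‖affineRep i (coverChart i z)‖ ^ 2 = ‖z‖ ^ 2 / ‖z i‖ ^ 2 := by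
  rw [affineRep_coverChart hz, norm_smul, norm_inv, mul_pow, inv_pow, inv_mul_eq_div]

theorem dropCoord_coverDeriv (hz : z i ≠ 0) (v : Cn n) :
    dropCoord i (coverDeriv i z v) = (z i)⁻¹ • (v - (v i / z i) • z) := by
  ext k
  by_cases hk : k = i
  · subst hk
    simp [dropCoord_apply, hz]
  · simp only [dropCoord_apply, hk, if_false, coverDeriv_apply_of_ne hk hz, PiLp.smul_apply,
      PiLp.sub_apply, smul_eq_mul]
    field_simp

theorem lineCoeff_coverDeriv (hz : z i ≠ 0) (v : Cn n) :
    lineCoeff i (coverChart i z) (coverDeriv i z v) =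
      inner ℂ z v / (‖z‖ ^ 2 : ℝ) - v i / z i := by
  have hnorm : (‖z‖ : ℂ) ≠ 0 := by
    exact_mod_cast norm_ne_zero_iff.2 (ne_zero_of_apply_ne_zero hz)
  have hconj : (starRingEnd ℂ) (z i) ≠ 0 := by simpa using hz
  have hzz : inner ℂ z z = (‖z‖ : ℂ) ^ 2 := inner_self_eq_norm_sq_to_K z
  have hzi : (‖z i‖ : ℂ) ^ 2 = z i * (starRingEnd ℂ) (z i) := (Complex.mul_conj' _).symm
  rw [lineCoeff_apply, norm_sq_affineRep_coverChart hz, affineRep_coverChart hz,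
    dropCoord_coverDeriv hz, inner_smul_left, inner_smul_right, inner_sub_right, inner_smul_right,
    hzz, map_inv₀]
  push_cast
  rw [hzi]
  field_simp

theorem horizontalPart_coverDeriv (hz : z i ≠ 0) (v : Cn n) :
    horizontalPart i (coverChart i z) (coverDeriv i z v) =
      (z i)⁻¹ • (v - (inner ℂ z v / (‖z‖ ^ 2 : ℝ)) • z) := by
  rw [horizontalPart_apply, lineCoeff_coverDeriv hz, dropCoord_coverDeriv hz,
    affineRep_coverChart hz]
  module

theorem verticalPart_coverDeriv (hz : z i ≠ 0) (v : Cn n) :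
    verticalPart i (coverChart i z) (coverDeriv i z v) =
      z i ^ n * (inner ℂ z v / (‖z‖ ^ 2 : ℝ)) := by
  have hn : (n : ℂ) ≠ 0 := by exact_mod_cast i.pos.ne'
  have hpow : z i ^ n = z i ^ (n - 1) * z i := by
    rw [← pow_succ, Nat.sub_add_cancel i.pos]
  rw [verticalPart_apply, lineCoeff_coverDeriv hz, coverDeriv_apply_self hz, coverChart_apply_self,
    hpow]
  field_simp
  ring

theorem radius_coverChart (hz : z i ≠ 0) :
    radius a i (coverChart i z) = a ^ n + (‖z‖ ^ 2) ^ n := by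
  have hzi : ‖z i‖ ≠ 0 := norm_ne_zero_iff.2 hz
  rw [radius, norm_sq_affineRep_coverChart hz, coverChart_apply_self, norm_pow, ← pow_mul,
    mul_comm n 2, pow_mul, ← mul_pow, mul_div_cancel₀ _ (pow_ne_zero 2 hzi)]

theorem rpow_radius_coverChart (ha : 0 < a) (hz : z i ≠ 0) :
    radius a i (coverChart i z) ^ (1 / n : ℝ) = scale n a (‖z‖ ^ 2) * ‖z‖ ^ 2 := by
  have hz0 := ne_zero_of_apply_ne_zero hz
  have ht : 0 < ‖z‖ ^ 2 := by positivity
  have hfactor : a ^ n + (‖z‖ ^ 2) ^ n = (1 + a ^ n / (‖z‖ ^ 2) ^ n) * (‖z‖ ^ 2) ^ n := by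
    field_simp
    ring
  rw [radius_coverChart hz, hfactor, Real.mul_rpow (by positivity) (by positivity), one_div,
    Real.pow_rpow_inv_natCast ht.le i.pos.ne', scale, one_div]

theorem inner_horizontalPart_coverDeriv (hz : z i ≠ 0) (v w : Cn n) :
    (inner ℂ (horizontalPart i (coverChart i z) (coverDeriv i z w))
      (horizontalPart i (coverChart i z) (coverDeriv i z v))).re =
      (‖z i‖ ^ 2)⁻¹ * ((inner ℂ w v).re - (inner ℂ z v * inner ℂ w z).re / ‖z‖ ^ 2) := by
  have hnorm : (‖z‖ : ℂ) ≠ 0 := by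
    exact_mod_cast norm_ne_zero_iff.2 (ne_zero_of_apply_ne_zero hz)
  have hzz : inner ℂ z z = (‖z‖ : ℂ) ^ 2 := inner_self_eq_norm_sq_to_K z
  have hzi : (((‖z i‖ ^ 2)⁻¹ : ℝ) : ℂ) = (starRingEnd ℂ) (z i)⁻¹ * (z i)⁻¹ := by
    push_cast
    rw [map_inv₀, ← Complex.mul_conj', mul_inv, mul_comm]
  have hinner : inner ℂ (horizontalPart i (coverChart i z) (coverDeriv i z w))
      (horizontalPart i (coverChart i z) (coverDeriv i z v)) =
      (((‖z i‖ ^ 2)⁻¹ : ℝ) : ℂ) *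
        (inner ℂ w v - (((‖z‖ ^ 2)⁻¹ : ℝ) : ℂ) * (inner ℂ z v * inner ℂ w z)) := by
    rw [hzi, horizontalPart_coverDeriv hz, horizontalPart_coverDeriv hz, inner_smul_left,
      inner_smul_right, inner_sub_left, inner_sub_right, inner_sub_right, inner_smul_left,
      inner_smul_left, inner_smul_right, inner_smul_right, hzz, ← inner_conj_symm w z, map_div₀,
      Complex.conj_ofReal]
    push_cast
    field_simp
    ring
  rw [hinner, Complex.re_ofReal_mul, Complex.sub_re, Complex.re_ofReal_mul]
  ring

theorem verticalPart_coverDeriv_mul_conj (hz : z i ≠ 0) (v w : Cn n) :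
    (verticalPart i (coverChart i z) (coverDeriv i z v) *
      (starRingEnd ℂ) (verticalPart i (coverChart i z) (coverDeriv i z w))).re =
      (‖z i‖ ^ 2) ^ n / (‖z‖ ^ 2) ^ 2 * (inner ℂ z v * inner ℂ w z).re := by
  rw [← Complex.re_ofReal_mul, verticalPart_coverDeriv hz, verticalPart_coverDeriv hz,
    ← inner_conj_symm w z, map_mul, map_pow, map_div₀, Complex.conj_ofReal]
  congr 1
  push_cast
  rw [← Complex.mul_conj', mul_pow]
  ring

theorem chartMetric_coverDeriv (ha : 0 < a) (hz : z i ≠ 0) (v w : Cn n) :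
    chartMetric a i (coverChart i z) (coverDeriv i z v) (coverDeriv i z w) =
      metricOnPunctured a z v w := by
  have hnorm : ‖z‖ ≠ 0 := norm_ne_zero_iff.2 (ne_zero_of_apply_ne_zero hz)
  have hnormi : ‖z i‖ ≠ 0 := norm_ne_zero_iff.2 hz
  rw [chartMetric_apply, inner_horizontalPart_coverDeriv hz, verticalPart_coverDeriv_mul_conj hz,
    horizontalWeight, verticalWeight, norm_sq_affineRep_coverChart hz,
    rpow_radius_coverChart ha hz, radius_coverChart hz, metricOnPunctured_eq, defect, div_pow]
  generalize (inner ℂ z v * inner ℂ w z).re = r, (inner ℂ w v).re = s, scale n a (‖z‖ ^ 2) = p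
  field_simp
  ring

theorem chartMetric_transition (ha : 0 < a) (hy : (chart i).symm y ∈ (chart j).source)
    (v w : Cn n) :
    chartMetric a j (transition i j y) (fderiv ℂ (transition i j) y v)
      (fderiv ℂ (transition i j) y w) = chartMetric a i y v w := by
  have hderiv : ContinuousAt (fderiv ℂ (transition i j)) y :=
    (contDiffAt_transition hy).continuousAt_fderiv (by simp)
  have hmetric : ContinuousAt (fun y => chartMetric a j (transition i j y)) y :=
    (contDiff_chartMetric ha j).continuous.continuousAt.comp (contDiffAt_transition hy).continuousAt
  refine eq_of_eventually_eq_of_apply_ne_zero (i := i)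
    (f := fun y => chartMetric a j (transition i j y) (fderiv ℂ (transition i j) y v)
      (fderiv ℂ (transition i j) y w))
    (g := fun y => chartMetric a i y v w) ?_ ?_ ?_
  · exact (hmetric.clm_apply (hderiv.clm_apply continuousAt_const)).clm_apply
      (hderiv.clm_apply continuousAt_const)
  · exact ((contDiff_chartMetric ha i).continuous.continuousAt.clm_apply
      continuousAt_const).clm_apply continuousAt_const
  · filter_upwards [eventually_chart_symm_mem_source hy] with x hxj hxi
    obtain ⟨z, hi, rfl⟩ := exists_coverChart_eq hxi
    obtain ⟨v, rfl⟩ := coverDeriv_surjective hi v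
    obtain ⟨w, rfl⟩ := coverDeriv_surjective hi w
    have hj := (chart_symm_coverChart_mem_source hi).1 hxj
    rw [fderiv_transition_coverDeriv hi hj, fderiv_transition_coverDeriv hi hj,
      transition_coverChart j hi, chartMetric_coverDeriv ha hi, chartMetric_coverDeriv ha hj]

end Pullback

/-! ### The Calabi-Eguchi-Hanson metric -/

section PosDef

variable {E : Type*} [NormedAddCommGroup E] [NormedSpace ℝ E] {G : E →L[ℝ] E →L[ℝ] ℝ}

theorem isCoercive_of_posDef [FiniteDimensional ℝ E] (hG : ∀ v, v ≠ 0 → 0 < G v v) :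
    IsCoercive G := by
  cases subsingleton_or_nontrivial E
  · exact ⟨1, one_pos, fun v => by simp [Subsingleton.elim v 0]⟩
  have hcont : Continuous fun v => G v v := G.continuous.clm_apply continuous_id
  obtain ⟨v₀, hv₀, hmin⟩ := (isCompact_sphere (0 : E) 1).exists_isMinOn
    (NormedSpace.sphere_nonempty.2 zero_le_one) hcont.continuousOn
  refine ⟨G v₀ v₀, hG v₀ (ne_zero_of_mem_unit_sphere ⟨v₀, hv₀⟩), fun v => ?_⟩
  by_cases hv : v = 0
  · simp [hv]
  have hnorm : 0 < ‖v‖ := norm_pos_iff.2 hv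
  have hle : G v₀ v₀ ≤ G (‖v‖⁻¹ • v) (‖v‖⁻¹ • v) :=
    hmin (by simp [norm_smul, hnorm.ne'])
  calc G v₀ v₀ * ‖v‖ * ‖v‖ ≤ G (‖v‖⁻¹ • v) (‖v‖⁻¹ • v) * ‖v‖ * ‖v‖ := by gcongr
    _ = G v v := by
      simp only [map_smul, smul_apply, smul_eq_mul]
      field_simp

theorem isVonNBounded_of_isCoercive (hG : IsCoercive G) :
    Bornology.IsVonNBounded ℝ {v : E | G v v < 1} := by
  obtain ⟨c, hc, hle⟩ := hG
  rw [NormedSpace.isVonNBounded_iff, isBounded_iff_forall_norm_le]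
  refine ⟨Real.sqrt c⁻¹, fun v (hv : G v v < 1) => Real.le_sqrt_of_sq_le ?_⟩
  rw [← one_div, le_div_iff₀ hc]
  linarith [hle v]

end PosDef

section GlobalMetric

variable {n : ℕ}

theorem chart_symm_chart_mem_source {x p : OMinus n} (hp : p ∈ (chart (chartIndex x)).source) :
    (chart (chartIndex x)).symm (chart (chartIndex x) p) ∈ (chart (chartIndex p)).source := by
  rw [(chart (chartIndex x)).left_inv hp]
  exact mem_chart_chartIndex_source p

theorem tangentCoordSymm_apply_eq {x p : OMinus n} (hp : p ∈ (chart (chartIndex x)).source)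
    (v : Cn n) :
    tangentCoordSymm x p v =
      fderiv ℂ (transition (chartIndex x) (chartIndex p)) (chart (chartIndex x) p) v := by
  rw [tangentCoordSymm_eq_fderiv hp]
  exact DFunLike.congr_fun ((hasFDerivAt_transition
    (chart_symm_chart_mem_source hp)).restrictScalars ℝ).fderiv v

theorem transition_chart (j : Fin n) {i : Fin n} {p : OMinus n} (hp : p ∈ (chart i).source) :
    transition i j (chart i p) = chart j p := by
  rw [transition, (chart i).left_inv hp]

variable {a : ℝ}

theorem chartMetric_tangentCoordSymm (ha : 0 < a) {x p : OMinus n}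
    (hp : p ∈ (chart (chartIndex x)).source) (v w : Cn n) :
    chartMetric a (chartIndex p) (chart (chartIndex p) p) (tangentCoordSymm x p v)
      (tangentCoordSymm x p w) = chartMetric a (chartIndex x) (chart (chartIndex x) p) v w := by
  rw [tangentCoordSymm_apply_eq hp, tangentCoordSymm_apply_eq hp, ← transition_chart _ hp]
  exact chartMetric_transition ha (chart_symm_chart_mem_source hp) v w

/-- The Calabi-Eguchi-Hanson metric on `𝒪(-n)`. -/
def calabiEguchiHanson (n : ℕ) {a : ℝ} (ha : 0 < a) : Metric n where
  inner p := chartMetric a (chartIndex p) (chart (chartIndex p) p)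
  symm p v w := chartMetric_symm a (chartIndex p) (chart (chartIndex p) p) v w
  pos p v hv := chartMetric_pos ha (chartIndex p) (chart (chartIndex p) p) hv
  isVonNBounded p := isVonNBounded_of_isCoercive (E := Cn n) <|
    isCoercive_of_posDef fun _ hv => chartMetric_pos ha (chartIndex p) (chart (chartIndex p) p) hv
  contMDiff x := by
    refine (Trivialization.contMDiffAt_section_iff (IB := 𝓘(ℝ, Cn n)) (n := ∞)
      (e := trivializationAt (Cn n →L[ℝ] Cn n →L[ℝ] ℝ) _ x) (x₀ := x) (by simp)).2 ?_
    have hchart : ContMDiffAt 𝓘(ℝ, Cn n) 𝓘(ℝ, Cn n →L[ℝ] Cn n →L[ℝ] ℝ) ∞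
        (fun p => chartMetric a (chartIndex x) (chart (chartIndex x) p)) x :=
      (contDiff_chartMetric ha (chartIndex x)).contMDiff.contMDiffAt.comp x
        (contMDiffAt_of_mem_maximalAtlas (I := 𝓘(ℝ, Cn n)) (n := ∞)
          (IsManifold.chart_mem_maximalAtlas x) (mem_chart_source (Cn n) x))
    refine hchart.congr_of_eventuallyEq ?_
    filter_upwards [chart_source_mem_nhds (Cn n) x] with p hp
    ext v w
    exact (trivializationAt_bilinearForm_apply hp
      (chartMetric a (chartIndex p) (chart (chartIndex p) p)) v w).trans
      (chartMetric_tangentCoordSymm ha hp v w)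

theorem mfderiv_cover_apply (z : punctured n) (v : Cn n) :
    mfderiv 𝓘(ℝ, Cn n) 𝓘(ℝ, Cn n) (cover n) z v = coverDeriv (chartIndex (cover n z)) z v :=
  DFunLike.congr_fun (hasMFDerivAt_of_chartAt_eventuallyEq (continuous_cover n).continuousAt
    (.of_forall fun w => chart_cover _ w)
    ((hasFDerivAt_coverChart (apply_chartIndex_cover_ne_zero z)).restrictScalars ℝ)).mfderiv v

theorem isCalabiEguchiHanson_calabiEguchiHanson (n : ℕ) (ha : 0 < a) :
    IsCalabiEguchiHanson a (calabiEguchiHanson n ha) := by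
  intro z v w
  refine (congrArg₂ (fun v w : Cn n => chartMetric a (chartIndex (cover n z))
    (chart (chartIndex (cover n z)) (cover n z)) v w)
    (mfderiv_cover_apply z v) (mfderiv_cover_apply z w)).trans ?_
  rw [chart_cover]
  exact chartMetric_coverDeriv ha (apply_chartIndex_cover_ne_zero z) v w

end GlobalMetric

/-! ### The trace of the Christoffel symbols in the standard charts -/

section ChartChristoffel

variable {n : ℕ} {a : ℝ} {i : Fin n} {z : Cn n}

theorem hasFDerivAt_dzForm {F : Type*} [NormedAddCommGroup F] [NormedSpace ℝ F]
    {V : Fin n → F → Cn n} {V' : Fin n → F →L[ℝ] Cn n} {y : F}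
    (hV : ∀ k, HasFDerivAt (V k) (V' k) y) :
    HasFDerivAt (fun y => dzForm n fun k => V k y)
      (((dzForm n).1.linearDeriv fun k => V k y).restrictScalars ℝ ∘L ContinuousLinearMap.pi V')
      y :=
  (((dzForm n).hasFDerivAt fun k => V k y).restrictScalars ℝ).comp y (hasFDerivAt_pi.2 hV)

/-- The second derivative of `coverChart`. -/
def coverDeriv₂ (i : Fin n) (z : Cn n) : Cn n →L[ℂ] Cn n →L[ℂ] Cn n := fderiv ℂ (coverDeriv i) z

theorem hasFDerivAt_coverDeriv (hz : z i ≠ 0) (v : Cn n) :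
    HasFDerivAt (fun z => coverDeriv i z v) (((coverDeriv₂ i z).flip v).restrictScalars ℝ) z := by
  have hdiff : DifferentiableAt ℂ (coverDeriv i) z :=
    ((contDiffAt_coverChart hz).fderiv_right (m := ω) (by simp)).differentiableAt (by simp)
  refine ((hdiff.hasFDerivAt.clm_apply (hasFDerivAt_const v z)).restrictScalars ℝ).congr_fderiv ?_
  ext u
  simp [coverDeriv₂]

theorem coverDeriv₂_comm (hz : z i ≠ 0) (u v : Cn n) : coverDeriv₂ i z u v = coverDeriv₂ i z v u :=
  ((contDiffAt_coverChart hz).isSymmSndFDerivAt (by simp)).eq u v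

theorem sum_dzForm_coverDeriv₂ (hz : z i ≠ 0) (u : Cn n) (W : Fin n → Cn n) :
    ∑ j, dzForm n (Function.update (fun k => coverDeriv i z (W k)) j (coverDeriv₂ i z u (W j))) =
      0 := by
  have hconst : (fun z => dzForm n fun k => coverDeriv i z (W k)) =ᶠ[𝓝 z]
      fun _ => n * dzForm n W := by
    filter_upwards [eventually_apply_ne_zero hz] with w hw
    exact dzForm_coverDeriv hw W
  have hderiv := (hasFDerivAt_dzForm fun k => hasFDerivAt_coverDeriv hz (W k)).unique
    ((hasFDerivAt_const _ _).congr_of_eventuallyEq hconst)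
  simpa [ContinuousMultilinearMap.linearDeriv_apply] using DFunLike.congr_fun hderiv u

/-- The Christoffel symbols of `chartMetric`. -/
def chartChristoffel (a : ℝ) (i : Fin n) (y : Cn n) : Cn n →L[ℝ] Cn n →L[ℝ] Cn n :=
  christoffel (chartMetric a i y) (fderiv ℝ (chartMetric a i) y)

theorem hasFDerivAt_chartMetric (ha : 0 < a) (i : Fin n) (y : Cn n) :
    HasFDerivAt (chartMetric a i) (fderiv ℝ (chartMetric a i) y) y :=
  ((contDiff_chartMetric ha i).differentiable (by simp) y).hasFDerivAt

variable [NeZero n]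

theorem fderiv_chartMetric_coverDeriv (ha : 0 < a) (hz : z i ≠ 0) (u v w : Cn n) :
    fderiv ℝ (chartMetric a i) (coverChart i z) (coverDeriv i z u) (coverDeriv i z v)
        (coverDeriv i z w) +
      chartMetric a i (coverChart i z) (coverDeriv₂ i z u v) (coverDeriv i z w) +
      chartMetric a i (coverChart i z) (coverDeriv i z v) (coverDeriv₂ i z u w) =
    metricOnPunctured a z (radialChristoffel a z u v) w +
      metricOnPunctured a z v (radialChristoffel a z u w) := by
  have hz0 := ne_zero_of_apply_ne_zero hz
  have hchart := (((hasFDerivAt_chartMetric ha i (coverChart i z)).comp z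
    ((hasFDerivAt_coverChart hz).restrictScalars ℝ)).clm_apply
      (hasFDerivAt_coverDeriv hz v)).clm_apply (hasFDerivAt_coverDeriv hz w)
  have hpullback : (fun z => chartMetric a i (coverChart i z) (coverDeriv i z v) (coverDeriv i z w))
      =ᶠ[𝓝 z] fun z => metricOnPunctured a z v w := by
    filter_upwards [eventually_apply_ne_zero hz] with x hx
    exact chartMetric_coverDeriv ha hx v w
  have hpunctured := (differentiableAt_metricOnPunctured ha hz0 v w).hasFDerivAt
  rw [← fderiv_metricOnPunctured_apply ha hz0,
    ← hchart.unique (hpunctured.congr_of_eventuallyEq hpullback)]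
  simp only [Function.comp_apply, ContinuousLinearMap.flip_add, add_apply,
    ContinuousLinearMap.comp_apply, ContinuousLinearMap.coe_restrictScalars',
    ContinuousLinearMap.flip_apply]
  ring

theorem chartChristoffel_coverDeriv (ha : 0 < a) (hz : z i ≠ 0) (u v : Cn n) :
    chartChristoffel a i (coverChart i z) (coverDeriv i z u) (coverDeriv i z v) =
      coverDeriv i z (radialChristoffel a z u v) - coverDeriv₂ i z u v := by
  refine christoffel_apply_eq (fun _ hv => chartMetric_pos ha i _ hv) (chartMetric_symm a i _)
    (coverDeriv_surjective hz)
    (B := fun u v => coverDeriv i z (radialChristoffel a z u v) - coverDeriv₂ i z u v)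
    (fun u v => by rw [radialChristoffel_comm, coverDeriv₂_comm hz]) (fun u v w => ?_) u v
  simp only [map_sub, sub_apply, chartMetric_coverDeriv ha hz]
  linear_combination -fderiv_chartMetric_coverDeriv ha hz u v w

theorem sum_dzForm_chartChristoffel_coverDeriv (ha : 0 < a) (hz : z i ≠ 0) (u : Cn n)
    (W : Fin n → Cn n) :
    ∑ j, dzForm n (Function.update (fun k => coverDeriv i z (W k)) j
      (chartChristoffel a i (coverChart i z) (coverDeriv i z u) (coverDeriv i z (W j)))) = 0 := by
  have hterm : ∀ j, dzForm n (Function.update (fun k => coverDeriv i z (W k)) j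
      (chartChristoffel a i (coverChart i z) (coverDeriv i z u) (coverDeriv i z (W j)))) =
      n * dzForm n (Function.update W j (radialChristoffel a z u (W j))) -
        dzForm n (Function.update (fun k => coverDeriv i z (W k)) j
          (coverDeriv₂ i z u (W j))) := fun j => by
    rw [chartChristoffel_coverDeriv ha hz, ContinuousAlternatingMap.map_update_sub,
      ← dzForm_coverDeriv hz]
    congr 2
    exact (funext fun k => Function.apply_update (fun _ => coverDeriv i z) W j _ k).symm
  rw [Finset.sum_congr rfl fun j _ => hterm j, Finset.sum_sub_distrib, ← Finset.mul_sum,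
    sum_dzForm_update, trace_radialChristoffel a (ne_zero_of_apply_ne_zero hz),
    sum_dzForm_coverDeriv₂ hz, zero_mul, mul_zero, sub_zero]

theorem sum_dzForm_chartChristoffel (ha : 0 < a) (i : Fin n) (y u : Cn n) (W : Fin n → Cn n) :
    ∑ j, dzForm n (Function.update W j (chartChristoffel a i y u (W j))) = 0 := by
  refine eq_of_eventually_eq_of_apply_ne_zero (i := i)
    (f := fun y => ∑ j, dzForm n (Function.update W j (chartChristoffel a i y u (W j))))
    (g := fun _ => 0) ?_ continuousAt_const (.of_forall fun y hy => ?_)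
  · refine tendsto_finsetSum _ fun j _ => ?_
    have hcont : ContinuousAt (fun y => chartChristoffel a i y u (W j)) y :=
      continuousAt_christoffel (contDiff_chartMetric ha i).continuous.continuousAt
        ((contDiff_chartMetric ha i).continuous_fderiv (by simp)).continuousAt
        (fun _ hv => chartMetric_pos ha i y hv) u (W j)
    exact (dzForm n).cont.continuousAt.comp (continuousAt_const.update j hcont)
  · obtain ⟨z, hz, rfl⟩ := exists_coverChart_eq hy
    obtain ⟨u, rfl⟩ := coverDeriv_surjective hz u
    choose V hV using fun k => coverDeriv_surjective hz (W k)
    obtain rfl : (fun k => coverDeriv i z (V k)) = W := funext hV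
    exact sum_dzForm_chartChristoffel_coverDeriv ha hz u V

end ChartChristoffel

/-! ### Parallelism of the volume form -/

section Parallel

variable {n : ℕ} {a : ℝ}

theorem metricCoord_cover {g : Metric n} (hg : IsCalabiEguchiHanson a g) {x : OMinus n}
    {z : punctured n} (hz : (z : Cn n) (chartIndex x) ≠ 0) (v w : Cn n) :
    metricCoord g x (cover n z) (coverDeriv (chartIndex x) z v) (coverDeriv (chartIndex x) z w) =
      metricOnPunctured a z v w := by
  have hz' := apply_chartIndex_cover_ne_zero z
  have hp : cover n z ∈ (chart (chartIndex x)).source := (cover_mem_chart_source_iff _ z).2 hz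
  rw [metricCoord_apply, tangentCoordSymm_apply_eq hp, tangentCoordSymm_apply_eq hp, chart_cover,
    fderiv_transition_coverDeriv hz hz', fderiv_transition_coverDeriv hz hz']
  exact (congrArg₂ (fun v w : Cn n => metricAt g (cover n z) v w)
    (mfderiv_cover_apply z v) (mfderiv_cover_apply z w)).symm.trans (hg z v w)

theorem metricCoord_eq_chartMetric (ha : 0 < a) {g : Metric n} (hg : IsCalabiEguchiHanson a g)
    (x : OMinus n) (y : Cn n) :
    metricCoord g x ((chart (chartIndex x)).symm y) = chartMetric a (chartIndex x) y := by
  refine eq_of_eventually_eq_of_apply_ne_zero (i := chartIndex x)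
    (f := fun y => metricCoord g x ((chart (chartIndex x)).symm y))
    (g := chartMetric a (chartIndex x)) ?_
    (contDiff_chartMetric ha (chartIndex x)).continuous.continuousAt (.of_forall fun y hy => ?_)
  · exact (contMDiffAt_metricCoord g ((chart (chartIndex x)).map_target trivial)).continuousAt.comp
      ((chart (chartIndex x)).continuousAt_symm trivial)
  · obtain ⟨z, hz, rfl⟩ := exists_coverChart_eq hy
    rw [chart_symm_coverChart hz]
    ext v w
    obtain ⟨v, rfl⟩ := coverDeriv_surjective hz v
    obtain ⟨w, rfl⟩ := coverDeriv_surjective hz w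
    rw [metricCoord_cover hg hz, chartMetric_coverDeriv ha hz]

theorem christoffelAt_eq_chartChristoffel (ha : 0 < a) {g : Metric n}
    (hg : IsCalabiEguchiHanson a g) (x : OMinus n) :
    christoffelAt g x = chartChristoffel a (chartIndex x) (chart (chartIndex x) x) := by
  have hmetric : metricAt g x = chartMetric a (chartIndex x) (chart (chartIndex x) x) := by
    rw [← metricCoord_eq_chartMetric ha hg,
      (chart (chartIndex x)).left_inv (mem_chart_chartIndex_source x), metricCoord_self]
  have hderiv : metricCoordDeriv g x =
      fderiv ℝ (chartMetric a (chartIndex x)) (chart (chartIndex x) x) :=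
    (hasFDerivAt_metricCoord g x).unique ((hasFDerivAt_chartMetric ha _ _).congr_of_eventuallyEq
      (.of_forall fun y => metricCoord_eq_chartMetric ha hg x y))
  rw [christoffelAt, hmetric, hderiv]
  rfl

theorem dzForm_tangentCoord {x p : OMinus n} (hp : p ∈ (chart (chartIndex x)).source)
    (v : Fin n → Cn n) : dzForm n (fun k => tangentCoord x p (v k)) = dzForm n v := by
  have h := dzForm_fderiv_transition (chart_symm_chart_mem_source hp)
    fun k => tangentCoord x p (v k)
  simp only [← tangentCoordSymm_apply_eq hp] at h
  rw [← h]
  congr 1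
  exact funext fun k => tangentCoordSymm_tangentCoord hp (v k)

theorem derivAt_volumeForm {x : OMinus n} {W : Fin n → OMinus n → Cn n}
    (hW : ∀ j, DifferentiableFieldAt (W j) x) (v : Cn n) :
    derivAt (fun p => volumeForm n p fun j => W j p) x v =
      ∑ j, volumeForm n x (Function.update (fun k => W k x) j (fieldCoordDeriv x (W j) v)) := by
  have hcoord : (fun p => volumeForm n p fun j => W j p) =ᶠ[𝓝 x]
      fun p => (n : ℂ)⁻¹ * dzForm n fun j => fieldCoord x (W j) p := by
    filter_upwards [chart_source_mem_nhds (Cn n) x] with p hp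
    exact congrArg ((n : ℂ)⁻¹ * ·) (dzForm_tangentCoord hp fun j => W j p).symm
  have hderiv := hasFDerivAt_dzForm fun k => hasFDerivAt_fieldCoord (hW k)
  simp only [(chartAt (Cn n) x).left_inv (mem_chart_source (Cn n) x), fieldCoord_self] at hderiv
  rw [derivAt_congr hcoord, derivAt_eq_of_hasFDerivAt (hderiv.const_mul (n : ℂ)⁻¹)]
  refine (congrArg ((n : ℂ)⁻¹ * ·) (ContinuousMultilinearMap.linearDeriv_apply _ _ _)).trans ?_
  rw [Finset.mul_sum]
  rfl

theorem sum_volumeForm_christoffelAt [NeZero n] (ha : 0 < a) {g : Metric n}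
    (hg : IsCalabiEguchiHanson a g) (x : OMinus n) (u : Cn n) (W : Fin n → Cn n) :
    ∑ j, volumeForm n x (Function.update W j (christoffelAt g x u (W j))) = 0 := by
  rw [christoffelAt_eq_chartChristoffel ha hg]
  exact (Finset.mul_sum _ _ ((n : ℂ)⁻¹)).symm.trans <| mul_eq_zero_of_right _ <|
    sum_dzForm_chartChristoffel ha (chartIndex x) (chart (chartIndex x) x) u W

theorem volumeForm_isParallel [NeZero n] (ha : 0 < a) {g : Metric n}
    (hg : IsCalabiEguchiHanson a g) {nabla : Connection n} (h : IsLeviCivita g nabla) :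
    IsParallel nabla (volumeForm n) := by
  intro x W hW v
  have hnabla (j : Fin n) : nabla (W j) x v =
      fieldCoordDeriv (E := Cn n) x (W j) v + christoffelAt (E := Cn n) g x v (W j x) :=
    (DFunLike.congr_fun (IsLeviCivitaOf.apply_eq (E := Cn n) h (hW j)) v).trans
      (covDeriv_apply (E := Cn n) g (W j) x v)
  have hterm (j : Fin n) :
      volumeForm n x (Function.update (fun k => W k x) j (nabla (W j) x v)) =
        volumeForm n x (Function.update (fun k => W k x) j
          (fieldCoordDeriv (E := Cn n) x (W j) v)) +
        volumeForm n x (Function.update (fun k => W k x) j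
          (christoffelAt (E := Cn n) g x v (W j x))) :=
    (congrArg (fun u : Cn n => volumeForm n x (Function.update (fun k => W k x) j u))
      (hnabla j)).trans ((volumeForm n x).map_update_add (fun k => W k x) j _ _)
  refine (derivAt_volumeForm (W := W) hW v).trans ?_
  rw [Finset.sum_congr rfl fun j _ => hterm j, Finset.sum_add_distrib]
  exact (add_eq_left.2 (sum_volumeForm_christoffelAt ha hg x v fun k => W k x)).symm

end Parallel

end CalabiEguchiHanson

end

theorem mainTheorem5 (n : ℕ) [NeZero n] :
    ∃ ηQ : CalabiEguchiHanson.TopForm n (CalabiEguchiHanson.PuncturedQuotient n),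
      ηQ.IsHolomorphic ∧
      ηQ.pullback (CalabiEguchiHanson.quotientMap n) =
        (CalabiEguchiHanson.stdForm n).pullback
          (Subtype.val : CalabiEguchiHanson.punctured n → CalabiEguchiHanson.Cn n) ∧
      ∃ η : CalabiEguchiHanson.TopForm n (CalabiEguchiHanson.OMinus n),
        η.IsHolomorphic ∧ (∀ x, η x ≠ 0) ∧
        η.pullback (Subtype.val : CalabiEguchiHanson.offZeroSection n →
            CalabiEguchiHanson.OMinus n) =
          ηQ.pullback (CalabiEguchiHanson.blowDown n) ∧
        ∀ a : ℝ, 0 < a →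
          (∃ g : CalabiEguchiHanson.Metric n, CalabiEguchiHanson.IsCalabiEguchiHanson a g) ∧
          ∀ g : CalabiEguchiHanson.Metric n, CalabiEguchiHanson.IsCalabiEguchiHanson a g →
            (∃ nabla, CalabiEguchiHanson.IsLeviCivita g nabla) ∧
            ∀ nabla, CalabiEguchiHanson.IsLeviCivita g nabla →
              CalabiEguchiHanson.IsParallel nabla η := by
  open CalabiEguchiHanson in
  exact ⟨quotientForm n, quotientForm_isHolomorphic n, quotientForm_pullback n, volumeForm n,
    volumeForm_isHolomorphic n, volumeForm_ne_zero, volumeForm_pullback n, fun _ ha =>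
      ⟨⟨calabiEguchiHanson n ha, isCalabiEguchiHanson_calabiEguchiHanson n ha⟩, fun g hg =>
        ⟨⟨leviCivita g, isLeviCivitaOf_leviCivita g⟩, fun _ h => volumeForm_isParallel ha hg h⟩⟩⟩
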